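/- Let $X$ be a zero-dimensional $\aleph_0$-space, that is, a regular Hausdorff space whose clopen subsets form a base of the topology and which has a countable $k$-network: a countable family $\mathcal N$ of subsets of $X$ such that for every open $U\subseteq X$ and compact $K\subseteq U$ there is a finite $\mathcal F\subseteq\mathcal N$ with $K\subseteq\bigcup\mathcal F\subseteq U$. Let $C_k(X)$ be the space of continuous functions $X\to\mathbb R$ with the compact-open topology and let $C_k(X,2)=\{f\in C_k(X): f(X)\subseteq\{0,1\}\}$ be its subspace. Then the following conditions are equivalent: 1. $C_k(X,2)$ is either metrizable or a cosmic $k_\omega$-space; 2. $C_k(X,2)$ is sequential; 3. $C_k(X,2)$ is a $k$-space; 4. $C_k(X,2)$ is Ascoli; 5. $C_k(X,2)$ contains no strong $\mathrm{Fin}^\omega$-fan; 6. either $X$ is hemicompact, or $X$ is Polish and the set $X'$ of non-isolated points of $X$ is compact. Here a topological space $Y$ is: - *cosmic* if it is regular Hausdorff and has a countable network, i.e. a countable family $\mathcal N$ of subsets such that for every open $U\subseteq Y$ and $y\in U$ there is $N\in\mathcal N$ with $y\in N\subseteq U$; - a *$k_\omega$-space* if it has a countable cover $\mathcal K$ by compact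 sets such that a set $F\subseteq Y$ is closed if and only if $F\cap K$ is closed in $K$ for every $K\in\mathcal K$; - *sequential* if for every non-closed $A\subseteq Y$ some sequence of points of $A$ converges to a point of $Y\setminus A$; - a *$k$-space* if a set $F\subseteq Y$ is closed whenever $F\cap K$ is closed in $K$ for every compact $K\subseteq Y$; - *Ascoli* if it is Tychonoff and for every compact $K\subseteq C_k(Y)$ the evaluation map $K\times Y\to\mathbb R$, $(f,y)\mapsto f(y)$, is continuous; - *hemicompact* if there is a countable family $\mathcal K$ of compact subsets of $Y$ such that every compact subset of $Y$ is contained in some $K\in\mathcal K$. A family $(A_n)_{n\in\omega}$ of subsets of $Y$ is *compact-finite* if for every compact $K\subseteq Y$ the set $\{n: K\cap A_n\neq\emptyset\}$ is finite, and *locally finite* if every point of $Y$ has a neighborhood $O$ such that $\{n: O\cap A_n\ne\emptyset\}$ is finite. A set $U\subseteq Y$ is *$\mathbb R$-open* if for every $y\in U$ there is a continuous $f:Y\to[0,1]$ with $f(y)=1$ and $f(Y\setminus U)\subseteq\{0\}$. A *strong $\mathrm{Fin}^\omega$-fan* in $Y$ is a family $(F_n)_{n\in\omega}$ of finite subsets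 of $Y$ that is compact-finite but not locally finite, and for which there are $\mathbb R$-open sets $U_n\supseteq F_n$ such that the family $(U_n)_{n\in\omega}$ is compact-finite. -/

import Mathlib

open Set Topology

/-- `X` is zero-dimensional: the clopen subsets form a base of the topology. -/
def IsZeroDimensional (X : Type*) [TopologicalSpace X] : Prop :=
  TopologicalSpace.IsTopologicalBasis {U : Set X | IsClopen U}

/-- `𝒩` is a network for `X`. -/
def IsNetwork {X : Type*} [TopologicalSpace X] (𝒩 : Set (Set X)) : Prop :=
  ∀ (x : X) (U : Set X), IsOpen U → x ∈ U → ∃ N ∈ 𝒩, x ∈ N ∧ N ⊆ U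

/-- `𝒩` is a `k`-network for `X`. -/
def IsKNetwork {X : Type*} [TopologicalSpace X] (𝒩 : Set (Set X)) : Prop :=
  ∀ U K : Set X, IsOpen U → IsCompact K → K ⊆ U →
    ∃ ℱ : Set (Set X), ℱ ⊆ 𝒩 ∧ ℱ.Finite ∧ K ⊆ ⋃₀ ℱ ∧ ⋃₀ ℱ ⊆ U

/-- A cosmic space: a regular (`T₃`) space with a countable network. -/
def IsCosmic (X : Type*) [TopologicalSpace X] : Prop :=
  T3Space X ∧ ∃ 𝒩 : Set (Set X), 𝒩.Countable ∧ IsNetwork 𝒩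

/-- An `ℵ₀`-space: a regular (`T₃`) space with a countable `k`-network. -/
def IsAlephZeroSpace (X : Type*) [TopologicalSpace X] : Prop :=
  T3Space X ∧ ∃ 𝒩 : Set (Set X), 𝒩.Countable ∧ IsKNetwork 𝒩

/-- A `k_ω`-space: there is a countable cover by compact sets that determines the topology. -/
def IsKOmegaSpace (X : Type*) [TopologicalSpace X] : Prop :=
  ∃ 𝒦 : Set (Set X), 𝒦.Countable ∧ (∀ K ∈ 𝒦, IsCompact K) ∧ ⋃₀ 𝒦 = univ ∧
    ∀ F : Set X, IsClosed F ↔ ∀ K ∈ 𝒦, IsClosed ((↑) ⁻¹' F : Set K)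

/-- A hemicompact space: there is a countable family of compact sets such that each compact
set is contained in a member of the family (such a family covers `X`, as points are compact). -/
def IsHemicompact (X : Type*) [TopologicalSpace X] : Prop :=
  ∃ 𝒦 : Set (Set X), 𝒦.Countable ∧ (∀ K ∈ 𝒦, IsCompact K) ∧
    ∀ C : Set X, IsCompact C → ∃ K ∈ 𝒦, C ⊆ K

/-- An Ascoli space: a Tychonoff space `X` such that each compact set `K` of `C_k(X)`
(Mathlib's topology on `C(X, ℝ)` is the compact-open topology) is evenly continuous. -/
def IsAscoli (X : Type*) [TopologicalSpace X] : Prop :=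
  T35Space X ∧ ∀ K : Set C(X, ℝ), IsCompact K →
    Continuous (fun p : K × X => (p.1 : C(X, ℝ)) p.2)

/-- A set `U` is `ℝ`-open if each point of `U` can be separated from the complement of `U`
by a continuous function into `[0, 1]`. -/
def IsROpen {X : Type*} [TopologicalSpace X] (U : Set X) : Prop :=
  ∀ x ∈ U, ∃ f : C(X, unitInterval), f x = 1 ∧ ∀ y ∉ U, f y = 0

/-- An indexed family of sets is compact-finite if each compact set meets only finitely many
of its members (counted with their indices). -/
def CompactFinite {X ι : Type*} [TopologicalSpace X] (F : ι → Set X) : Prop :=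
  ∀ K : Set X, IsCompact K → {i | (K ∩ F i).Nonempty}.Finite

/-- A fan: an indexed family of sets that is compact-finite but not locally finite. -/
def IsFan {X ι : Type*} [TopologicalSpace X] (F : ι → Set X) : Prop :=
  CompactFinite F ∧ ¬ LocallyFinite F

/-- A strong fan: its members have `ℝ`-open neighborhoods that form a compact-finite family. -/
def IsStrongFan {X ι : Type*} [TopologicalSpace X] (F : ι → Set X) : Prop :=
  IsFan F ∧ ∃ U : ι → Set X, (∀ i, IsROpen (U i) ∧ F i ⊆ U i) ∧ CompactFinite U

/-- `X` contains a strong `Fin^ω`-fan: a strong fan of finite sets, indexed by `ω`. -/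
def ContainsStrongFinOmegaFan (X : Type*) [TopologicalSpace X] : Prop :=
  ∃ F : ℕ → Set X, (∀ n, (F n).Finite) ∧ IsStrongFan F

/-- `C_k(X, 2)`: the subspace of `C_k(X)` that consists of the functions with values in
`{0, 1}`; the topology is induced by the compact-open topology of `C(X, ℝ)`. -/
abbrev CkTwo (X : Type*) [TopologicalSpace X] : Type _ :=
  {f : C(X, ℝ) // range f ⊆ {0, 1}}

/-- The set `X'` of non-isolated points of `X`. -/
def nonIsolatedPoints (X : Type*) [TopologicalSpace X] : Set X :=
  {x | ¬ IsOpen ({x} : Set X)}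

/-! The conditions are proved in a cycle. Since functions in `CkTwo X` take two values, basic
neighborhoods of `f` are the sets of all `g` that agree with `f` on a compact set. As `X` is
separable, compact sets of functions embed in a countable power of the reals, so the k-property
gives sequentiality. A k-space is Ascoli by currying, and evaluation at a null sequence of bump
functions excludes strong fans in an Ascoli space.

The core is 5 → 6. If `X` is not hemicompact, noncompact closed sets `N n` shrink to some compact
`C` (`exists_noncompact_seq`). Points of `N n` serve as markers: functions vanishing on `C` but not
at the markers cannot stay in one compact set for infinitely many `n`
(`containsStrongFinOmegaFan_of_seq`). So a fan arises once the functions with fixed `n` are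
dispersed. Three failures give such functions: `X'` is not compact; a non-closed set off `C` meets
each compact set finitely; or countably many compact sets are not almost contained in one compact
set. Without them a countable compact network contains a base, and a metric penalizing distance from
`C` is complete.

For 6 → 1, hemicompactness gives a countable base of `CkTwo X`. If `X` is metrizable and `X'` is
compact, prescribing values near `X'` leaves a Cantor-type compact set, and countably many of these
determine the topology. -/

/-! ### Networks and compact-finite families -/

/-- Every compact subset of an open set is separated from its complement by a member of `𝒩`. -/
def IsCompactNetwork {X : Type*} [TopologicalSpace X] (𝒩 : Set (Set X)) : Prop :=
  ∀ U K : Set X, IsOpen U → IsCompact K → K ⊆ U → ∃ N ∈ 𝒩, K ⊆ N ∧ N ⊆ U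

theorem IsKNetwork.isNetwork {X : Type*} [TopologicalSpace X] {𝒩 : Set (Set X)}
    (h : IsKNetwork 𝒩) : IsNetwork 𝒩 := by
  intro x U hU hx
  obtain ⟨ℱ, hℱ, -, h1, h2⟩ := h U {x} hU isCompact_singleton (by simpa using hx)
  obtain ⟨N, hN, hxN⟩ := h1 rfl
  exact ⟨N, hℱ hN, hxN, (subset_sUnion_of_mem hN).trans h2⟩

theorem IsNetwork.lindelofSpace {X : Type*} [TopologicalSpace X] {𝒩 : Set (Set X)}
    (h : IsNetwork 𝒩) (hc : 𝒩.Countable) : LindelofSpace X := by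
  rw [← isLindelof_univ_iff]
  refine isLindelof_of_countable_subcover fun {ι} U hU hcov => ?_
  classical
  let good : Set (Set X) := {N ∈ 𝒩 | ∃ i, N ⊆ U i}
  have hgood : ∀ N : good, ∃ i, (N : Set X) ⊆ U i := fun N => N.2.2
  choose i hi using hgood
  have : Countable good := (hc.mono fun N hN => hN.1).to_subtype
  refine ⟨range i, countable_range i, fun x hx => ?_⟩
  obtain ⟨j, hj⟩ := mem_iUnion.1 (hcov hx)
  obtain ⟨N, hN, hxN, hNU⟩ := h x (U j) (hU j) hj
  exact mem_biUnion (mem_range_self (⟨N, hN, j, hNU⟩ : good)) (hi _ hxN)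

theorem IsNetwork.separableSpace {X : Type*} [TopologicalSpace X] {𝒩 : Set (Set X)}
    (h : IsNetwork 𝒩) (hc : 𝒩.Countable) : TopologicalSpace.SeparableSpace X := by
  classical
  let good : Set (Set X) := {N ∈ 𝒩 | N.Nonempty}
  have hgood : ∀ N : good, (N : Set X).Nonempty := fun N => N.2.2
  choose p hp using hgood
  have : Countable good := (hc.mono fun N hN => hN.1).to_subtype
  refine ⟨range p, countable_range p, fun x => mem_closure_iff.2 fun U hU hx => ?_⟩
  obtain ⟨N, hN, hxN, hNU⟩ := h x U hU hx
  exact ⟨_, hNU (hp ⟨N, hN, x, hxN⟩), mem_range_self _⟩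

theorem IsNetwork.countable_isolated {X : Type*} [TopologicalSpace X] {𝒩 : Set (Set X)}
    (h : IsNetwork 𝒩) (hc : 𝒩.Countable) : {x : X | IsOpen ({x} : Set X)}.Countable := by
  refine MapsTo.countable_of_injOn (f := fun x : X => ({x} : Set X)) (t := 𝒩) (fun x hx => ?_)
    (singleton_injective.injOn) hc
  obtain ⟨N, hN, hxN, hNU⟩ := h x {x} hx rfl
  have : N = {x} := hNU.antisymm (by simpa using hxN)
  rwa [this] at hN

/-- Finite unions of members of the k-network do it; closure under unions is what later lets two
members on opposite sides of a clopen set be treated as one. -/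
theorem IsKNetwork.exists_isCompactNetwork {X : Type*} [TopologicalSpace X] {𝒩 : Set (Set X)}
    (h : IsKNetwork 𝒩) (hc : 𝒩.Countable) :
    ∃ 𝓜 : Set (Set X), 𝓜.Countable ∧ IsCompactNetwork 𝓜 ∧ ∀ A ∈ 𝓜, ∀ B ∈ 𝓜, A ∪ B ∈ 𝓜 := by
  refine ⟨sUnion '' {ℱ | ℱ.Finite ∧ ℱ ⊆ 𝒩}, (countable_ofPred_finite_subset hc).image _, ?_, ?_⟩
  · intro U K hU hK hKU
    obtain ⟨ℱ, h1, h2, h3, h4⟩ := h U K hU hK hKU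
    exact ⟨_, mem_image_of_mem _ ⟨h2, h1⟩, h3, h4⟩
  · rintro _ ⟨ℱ, h1, rfl⟩ _ ⟨𝒢, h2, rfl⟩
    exact ⟨ℱ ∪ 𝒢, ⟨h1.1.union h2.1, union_subset h1.2 h2.2⟩, sUnion_union _ _⟩

theorem IsCompactNetwork.image_closure {X : Type*} [TopologicalSpace X] [RegularSpace X]
    {𝓜 : Set (Set X)} (h : IsCompactNetwork 𝓜) : IsCompactNetwork (closure '' 𝓜) := by
  intro U K hU hK hKU
  obtain ⟨V, hV, hKV, hVU⟩ := hK.exists_isOpen_closure_subset (hU.mem_nhdsSet.2 hKU)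
  obtain ⟨N, hN, h1, h2⟩ := h V K hV hK hKV
  exact ⟨_, mem_image_of_mem _ hN, h1.trans subset_closure, (closure_mono h2).trans hVU⟩

theorem IsCompact.union_of_finite_diff {X : Type*} [TopologicalSpace X] {C S : Set X}
    (hC : IsCompact C) (hS : ∀ V, IsOpen V → C ⊆ V → (S \ V).Finite) : IsCompact (C ∪ S) := by
  classical
  refine isCompact_of_finite_subcover fun {ι} U hU hcov => ?_
  obtain ⟨t, ht⟩ := hC.elim_finite_subcover U hU (subset_union_left.trans hcov)
  obtain ⟨s, hs⟩ := (hS (⋃ i ∈ t, U i) (isOpen_biUnion fun i _ => hU i) ht).isCompact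
    |>.elim_finite_subcover U hU (sdiff_subset.trans (subset_union_right.trans hcov))
  refine ⟨t ∪ s, ?_⟩
  rw [Finset.set_biUnion_union]
  rintro x (hx | hx)
  · exact Or.inl (ht hx)
  · by_cases hxt : x ∈ ⋃ i ∈ t, U i
    · exact Or.inl hxt
    · exact Or.inr (hs ⟨hx, hxt⟩)

theorem CompactFinite.comp_injective {X ι κ : Type*} [TopologicalSpace X] {F : ι → Set X}
    (h : CompactFinite F) {s : κ → ι} (hs : Function.Injective s) :
    CompactFinite fun k => F (s k) :=
  fun K hK => (h K hK).preimage (f := s) hs.injOn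

theorem CompactFinite.mono {X ι : Type*} [TopologicalSpace X] {F F' : ι → Set X}
    (h : CompactFinite F) (hs : ∀ i, F' i ⊆ F i) : CompactFinite F' :=
  fun K hK => (h K hK).subset fun i hi => hi.mono (inter_subset_inter_right _ (hs i))

theorem CompactFinite.preimage {X Y ι : Type*} [TopologicalSpace X] [TopologicalSpace Y]
    {F : ι → Set Y} (h : CompactFinite F) {r : X → Y} (hr : Continuous r) :
    CompactFinite fun i => r ⁻¹' F i := by
  refine fun K hK => (h (r '' K) (hK.image hr)).subset ?_
  rintro i ⟨x, hx, hxF⟩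
  exact ⟨r x, mem_image_of_mem r hx, hxF⟩

/-! ### Clopen partitions of zero-dimensional Lindelöf spaces -/

/-- Countable clopen partition with compact-finite members refining a given choice of
neighborhoods. -/
theorem IsZeroDimensional.exists_clopen_partition {X : Type*} [TopologicalSpace X] [LindelofSpace X]
    (hX : IsZeroDimensional X) (O : X → Set X) (hO : ∀ x, O x ∈ 𝓝 x) :
    ∃ P : ℕ → Set X, (∀ i, IsClopen (P i)) ∧ (∀ i, P i = ∅ ∨ ∃ x, P i ⊆ O x) ∧ ⋃ i, P i = univ ∧
      Pairwise (Function.onFun Disjoint P) ∧ CompactFinite P := by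
  have hcl : ∀ x, ∃ U, IsClopen U ∧ x ∈ U ∧ U ⊆ O x := fun x => by
    obtain ⟨U, h1, h2, h3⟩ := hX.mem_nhds_iff.1 (hO x)
    exact ⟨U, h1, h2, h3⟩
  choose U hU hxU hUO using hcl
  obtain ⟨t, ht, hcov⟩ := isLindelof_univ.elim_countable_subcover U (fun x => (hU x).isOpen)
    (fun x _ => mem_iUnion.2 ⟨x, hxU x⟩)
  obtain ⟨u, hu⟩ : ∃ u : ℕ → Set X, (∀ i, u i = ∅ ∨ ∃ x, u i = U x) ∧ ⋃ i, u i = univ := by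
    rcases t.eq_empty_or_nonempty with rfl | hne
    · exact ⟨fun _ => ∅, fun i => Or.inl rfl, by simpa [eq_comm, univ_eq_empty_iff] using hcov⟩
    · obtain ⟨v, hv⟩ := ht.exists_eq_range hne
      refine ⟨fun i => U (v i), fun i => Or.inr ⟨_, rfl⟩, eq_univ_of_univ_subset ?_⟩
      rw [hv, biUnion_range] at hcov
      exact hcov
  have hucl : ∀ i, IsClopen (u i) := fun i => by
    rcases hu.1 i with h | ⟨x, h⟩
    · rw [h]; exact isClopen_empty
    · rw [h]; exact hU x
  refine ⟨disjointed u, fun i => ?_, fun i => ?_, ?_, disjoint_disjointed u, fun K hK => ?_⟩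
  · rw [disjointed_apply]
    refine (hucl i).diff ?_
    rw [Finset.sup_set_eq_biUnion]
    exact isClopen_biUnion_finset fun j _ => hucl j
  · rcases hu.1 i with h | ⟨x, h⟩
    · exact Or.inl (subset_empty_iff.1 ((disjointed_le u i).trans h.le))
    · exact Or.inr ⟨x, (disjointed_le u i).trans (h.le.trans (hUO x))⟩
  · rw [iUnion_disjointed, hu.2]
  -- Finitely many `u j` cover `K`, and the disjointed sets of larger index avoid all of these.
  · obtain ⟨s, hs⟩ := hK.elim_finite_subcover u (fun i => (hucl i).isOpen) (by rw [hu.2]; simp)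
    refine (finite_le_nat (s.sup id)).subset ?_
    rintro i ⟨x, hxK, hx⟩
    obtain ⟨j, hj, hxj⟩ := mem_iUnion₂.1 (hs hxK)
    by_contra hlt
    simp only [mem_ofPred_eq, not_le] at hlt
    have hji : j < i := lt_of_le_of_lt (Finset.le_sup (f := id) hj) hlt
    rw [disjointed_apply, Finset.sup_set_eq_biUnion] at hx
    exact hx.2 (mem_biUnion (Finset.mem_coe.2 (Finset.mem_Iio.2 hji)) hxj)

/-- A closed noncompact subset of a zero-dimensional Lindelöf space meets infinitely many members of
a compact-finite disjoint sequence of clopen sets. -/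
theorem IsZeroDimensional.exists_clopen_seq {X : Type*} [TopologicalSpace X] [LindelofSpace X]
    (hX : IsZeroDimensional X) {H C : Set X} (hH : IsClosed H) (hHc : ¬ IsCompact H)
    (hC : IsCompact C) :
    ∃ Q : ℕ → Set X, (∀ m, IsClopen (Q m)) ∧ (∀ m, Disjoint (Q m) C) ∧
      (∀ m, (Q m ∩ H).Nonempty) ∧ Pairwise (Function.onFun Disjoint Q) ∧ CompactFinite Q := by
  classical
  have : ∃ (ι : Type _) (U : ι → Set X), (∀ i, IsOpen (U i)) ∧ H ⊆ ⋃ i, U i ∧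
      ∀ t : Finset ι, ¬ H ⊆ ⋃ i ∈ t, U i := by
    by_contra! hcon
    exact hHc (isCompact_of_finite_subcover fun {ι} U hU hcov => hcon ι U hU hcov)
  obtain ⟨ι, U, hU, hcov, hfin⟩ := this
  -- Each neighborhood either lies in a member of the bad cover or misses `H`. If only finitely many
  -- partition pieces met `H`, they would yield a finite subcover.
  have hO : ∀ x, ∃ O ∈ 𝓝 x, (O ∩ H).Nonempty → ∃ i, O ⊆ U i := fun x => by
    by_cases hx : x ∈ H
    · obtain ⟨i, hi⟩ := mem_iUnion.1 (hcov hx)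
      exact ⟨U i, (hU i).mem_nhds hi, fun _ => ⟨i, subset_rfl⟩⟩
    · refine ⟨Hᶜ, hH.isOpen_compl.mem_nhds hx, fun h => ?_⟩
      simp at h
  choose O hO hOU using hO
  obtain ⟨P, hP, hPO, hPu, hPd, hPf⟩ := hX.exists_clopen_partition O hO
  have hinf : {i | (P i ∩ H).Nonempty}.Infinite := by
    intro hf
    have hsub : ∀ i, (P i ∩ H).Nonempty → ∃ j, P i ⊆ U j := fun i hi => by
      rcases hPO i with h | ⟨x, hx⟩
      · simp [h] at hi
      · obtain ⟨j, hj⟩ := hOU x (hi.mono (inter_subset_inter_left _ hx))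
        exact ⟨j, hx.trans hj⟩
    have : Nonempty ι := by
      by_contra hι
      rw [not_nonempty_iff] at hι
      exact hfin ∅ (by simpa using hcov)
    choose! j hj using hsub
    refine hfin (hf.toFinset.image j) fun x hx => ?_
    obtain ⟨i, hi⟩ := mem_iUnion.1 (hPu.ge (mem_univ x))
    have hne : (P i ∩ H).Nonempty := ⟨x, hi, hx⟩
    exact mem_biUnion (Finset.mem_coe.2 (Finset.mem_image_of_mem j (hf.mem_toFinset.2 hne)))
      (hj i hne hi)
  have hinf' := hinf.sdiff (hPf C hC)
  let e := hinf'.natEmbedding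
  have hinj : Function.Injective fun m => (e m : ℕ) := Subtype.val_injective.comp e.injective
  refine ⟨fun m => P (e m), fun m => hP _, fun m => ?_, fun m => (e m).2.1,
    fun a b hab => hPd (hinj.ne hab), hPf.comp_injective hinj⟩
  rw [disjoint_comm, disjoint_iff_inter_eq_empty, ← not_nonempty_iff_eq_empty]
  exact (e m).2.2

/-! ### A criterion for being Polish -/

/-- A second countable regular space whose points outside a nonempty compact set are isolated is
Polish. -/
theorem polishSpace_of_isolated_compl {X : Type*} [TopologicalSpace X] [T3Space X]
    [SecondCountableTopology X] {C : Set X} (hC : IsCompact C) (hne : C.Nonempty)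
    (hiso : ∀ x ∉ C, IsOpen ({x} : Set X)) : PolishSpace X := by
  classical
  -- Distinct points also pay their distances to `C`. The topology is unchanged, as the penalty
  -- vanishes on `C` and other points are isolated, while a `d`-Cauchy sequence that is not
  -- eventually constant must approach `C`.
  let d : X → X → ℝ := fun x y =>
    letI := TopologicalSpace.metrizableSpaceMetric X
    if x = y then 0 else dist x y + Metric.infDist x C + Metric.infDist y C
  have hself : ∀ x, d x x = 0 := fun x => by simp [d]
  have hcomm : ∀ x y, d x y = d y x := fun x y => by
    let := TopologicalSpace.metrizableSpaceMetric X
    simp only [d, eq_comm (a := x), dist_comm x]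
    split_ifs <;> ring
  have hle : ∀ x y, (letI := TopologicalSpace.metrizableSpaceMetric X; dist x y) ≤ d x y :=
    fun x y => by
      let := TopologicalSpace.metrizableSpaceMetric X
      simp only [d]
      split_ifs with h
      · simp [h]
      · linarith [Metric.infDist_nonneg (x := x) (s := C), Metric.infDist_nonneg (x := y) (s := C)]
  have htri : ∀ x y z, d x z ≤ d x y + d y z := fun x y z => by
    let := TopologicalSpace.metrizableSpaceMetric X
    have h1 := Metric.infDist_nonneg (x := x) (s := C)
    have h2 := Metric.infDist_nonneg (x := y) (s := C)
    have h3 := Metric.infDist_nonneg (x := z) (s := C)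
    have h4 := dist_triangle x y z
    have h5 := dist_nonneg (x := x) (y := y)
    have h6 := dist_nonneg (x := y) (y := z)
    by_cases hxy : x = y
    · subst hxy; simp [d]
    by_cases hyz : y = z
    · subst hyz; simp [d]
    simp only [d, hxy, hyz, if_false]
    split_ifs <;> linarith
  have htop : ∀ s : Set X, IsOpen s ↔ ∀ x ∈ s, ∃ ε > 0, ∀ y, d x y < ε → y ∈ s := fun s => by
    let := TopologicalSpace.metrizableSpaceMetric X
    rw [Metric.isOpen_iff]
    refine forall₂_congr fun x hx => ⟨fun ⟨ε, hε, h⟩ => ⟨ε, hε, fun y hy => h ?_⟩, ?_⟩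
    · rw [Metric.mem_ball']
      exact (hle x y).trans_lt hy
    · rintro ⟨ε, hε, h⟩
      by_cases hxC : x ∈ C
      · refine ⟨ε / 2, half_pos hε, fun y hy => h y ?_⟩
        rw [Metric.mem_ball'] at hy
        have h1 := Metric.infDist_zero_of_mem hxC
        have h2 : Metric.infDist y C ≤ dist x y := by
          rw [dist_comm]; exact Metric.infDist_le_dist_of_mem hxC
        simp only [d]
        split_ifs
        · exact hε
        · linarith
      · obtain ⟨δ, hδ, hδs⟩ := Metric.isOpen_iff.1 (hiso x hxC) x rfl
        refine ⟨δ, hδ, fun y hy => ?_⟩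
        rw [hδs hy]
        exact hx
  have hcomplete : ∀ u : ℕ → X, (∀ ε > 0, ∃ N, ∀ m ≥ N, ∀ n ≥ N, d (u m) (u n) < ε) →
      ∃ c, Filter.Tendsto u Filter.atTop (𝓝 c) := fun u hu => by
    let := TopologicalSpace.metrizableSpaceMetric X
    have hcau : CauchySeq u := Metric.cauchySeq_iff.2 fun ε hε => by
      obtain ⟨N, hN⟩ := hu ε hε
      exact ⟨N, fun m hm n hn => (hle _ _).trans_lt (hN m hm n hn)⟩
    by_cases hconst : ∃ N, ∀ n ≥ N, u n = u N
    · obtain ⟨N, hN⟩ := hconst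
      exact ⟨u N, tendsto_atTop_of_eventually_const hN⟩
    push Not at hconst
    have hρ : Filter.Tendsto (fun n => Metric.infDist (u n) C) Filter.atTop (𝓝 0) := by
      rw [Metric.tendsto_atTop]
      intro ε hε
      obtain ⟨N, hN⟩ := hu ε hε
      refine ⟨N, fun n hn => ?_⟩
      obtain ⟨m, hm, hmn⟩ := hconst n
      have h1 := hN m (hn.le.trans hm) n hn
      simp only [d, hmn, if_false] at h1
      have h2 := Metric.infDist_nonneg (x := u n) (s := C)
      have h3 := Metric.infDist_nonneg (x := u m) (s := C)
      have h4 := dist_nonneg (x := u m) (y := u n)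
      rw [Real.dist_eq, sub_zero, abs_of_nonneg h2]
      linarith
    choose c hcC hc using fun n => hC.exists_infDist_eq_dist hne (u n)
    obtain ⟨a, -, φ, hφ, ha⟩ := hC.tendsto_subseq hcC
    refine ⟨a, tendsto_nhds_of_cauchySeq_of_subseq hcau hφ.tendsto_atTop ?_⟩
    refine ha.congr_dist ?_
    have := hρ.comp hφ.tendsto_atTop
    refine this.congr fun n => ?_
    simp only [Function.comp, hc, dist_comm]
  have heq : ∀ x y, d x y = 0 → x = y := fun x y h => by
    let := TopologicalSpace.metrizableSpaceMetric X
    exact dist_le_zero.1 ((hle x y).trans h.le)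
  have hcm : TopologicalSpace.IsCompletelyMetrizableSpace X :=
    ⟨⟨MetricSpace.ofDistTopology d hself hcomm htri htop heq, rfl, by
      let := MetricSpace.ofDistTopology d hself hcomm htri htop heq
      exact Metric.complete_of_cauchySeq_tendsto fun u hu =>
        hcomplete u (Metric.cauchySeq_iff.1 hu)⟩⟩
  exact { }

theorem secondCountableTopology_of_countable_network {X : Type*} [TopologicalSpace X]
    {𝒩 : Set (Set X)} (hc : 𝒩.Countable)
    (h : ∀ (x : X) (U : Set X), IsOpen U → x ∈ U → ∃ N ∈ 𝒩, IsOpen N ∧ x ∈ N ∧ N ⊆ U) :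
    SecondCountableTopology X := by
  have hb : TopologicalSpace.IsTopologicalBasis {N ∈ 𝒩 | IsOpen N} :=
    TopologicalSpace.isTopologicalBasis_of_isOpen_of_nhds (fun _ hu => hu.2) fun x U hx hU => by
      obtain ⟨N, hN, hNo, hxN, hNU⟩ := h x U hU hx
      exact ⟨N, ⟨hN, hNo⟩, hxN, hNU⟩
  exact hb.secondCountableTopology (hc.mono fun _ hN => hN.1)

/-! ### The space of continuous `{0, 1}`-valued functions -/

namespace CkTwo

variable {X : Type*} [TopologicalSpace X]

instance : FunLike (CkTwo X) X ℝ where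
  coe f := f.1
  coe_injective _ _ h := Subtype.ext (DFunLike.coe_injective h)

theorem apply_eq_zero_or_one (f : CkTwo X) (x : X) : f x = 0 ∨ f x = 1 :=
  f.2 (mem_range_self x)

theorem continuous_coe (f : CkTwo X) : Continuous f := f.1.continuous

theorem isClopen_fiber (f : CkTwo X) (r : ℝ) (hr : r = 0 ∨ r = 1) : IsClopen {x | f x = r} := by
  refine ⟨isClosed_eq f.continuous_coe continuous_const, ?_⟩
  have : {x | f x = r} = f ⁻¹' Metric.ball r (1 / 2) := by
    ext x
    rcases f.apply_eq_zero_or_one x with h | h <;> rcases hr with rfl | rfl <;>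
      simp [h, Real.dist_eq] <;> norm_num
  rw [this]
  exact Metric.isOpen_ball.preimage f.continuous_coe

theorem isOpen_eq (f g : CkTwo X) : IsOpen {x | f x = g x} := by
  have : {x | f x = g x} = ({x | f x = 0} ∩ {x | g x = 0}) ∪ ({x | f x = 1} ∩ {x | g x = 1}) := by
    ext x
    rcases f.apply_eq_zero_or_one x with h | h <;> rcases g.apply_eq_zero_or_one x with h' | h' <;>
      simp [h, h']
  rw [this]
  exact ((f.isClopen_fiber 0 (by simp)).inter (g.isClopen_fiber 0 (by simp))).isOpen.union
    ((f.isClopen_fiber 1 (by simp)).inter (g.isClopen_fiber 1 (by simp))).isOpen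

open Classical in
/-- The characteristic function of a clopen set. -/
noncomputable def ind (W : Set X) (hW : IsClopen W) : CkTwo X :=
  ⟨⟨W.indicator 1, (IsClopen.continuous_indicator hW continuous_one)⟩, by
    rintro _ ⟨x, rfl⟩
    by_cases h : x ∈ W <;> simp [h]⟩

theorem ind_of_mem {W : Set X} (hW : IsClopen W) {x : X} (hx : x ∈ W) : ind W hW x = 1 :=
  indicator_of_mem hx _

theorem ind_of_notMem {W : Set X} (hW : IsClopen W) {x : X} (hx : x ∉ W) : ind W hW x = 0 :=
  indicator_of_notMem hx _

theorem isOpen_eqOn (f : CkTwo X) {K : Set X} (hK : IsCompact K) :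
    IsOpen {g : CkTwo X | EqOn g f K} := by
  have h1 : IsCompact (K ∩ {x | f x = 1}) := hK.inter_right (f.isClopen_fiber 1 (by simp)).1
  have h0 : IsCompact (K ∩ {x | f x = 0}) := hK.inter_right (f.isClopen_fiber 0 (by simp)).1
  have e : {g : CkTwo X | EqOn g f K} = (Subtype.val ⁻¹' {g : C(X, ℝ) | MapsTo g (K ∩ {x | f x = 1}) (Ioi (1 / 2))})
      ∩ (Subtype.val ⁻¹' {g : C(X, ℝ) | MapsTo g (K ∩ {x | f x = 0}) (Iio (1 / 2))}) := by
    ext g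
    refine ⟨fun h => ⟨fun x hx => ?_, fun x hx => ?_⟩, fun h x hx => ?_⟩
    · have : g x = 1 := (h hx.1).trans hx.2
      change (1 / 2 : ℝ) < g x
      rw [this]; norm_num
    · have : g x = 0 := (h hx.1).trans hx.2
      change g x < (1 / 2 : ℝ)
      rw [this]; norm_num
    · rcases f.apply_eq_zero_or_one x with hf | hf
      · have : g x < 1 / 2 := h.2 ⟨hx, hf⟩
        rcases g.apply_eq_zero_or_one x with hg | hg
        · rw [hf, hg]
        · rw [hg] at this; norm_num at this
      · have : 1 / 2 < g x := h.1 ⟨hx, hf⟩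
        rcases g.apply_eq_zero_or_one x with hg | hg
        · rw [hg] at this; norm_num at this
        · rw [hf, hg]
  rw [e]
  exact ((ContinuousMap.isOpen_setOfPred_mapsTo h1 isOpen_Ioi).preimage continuous_subtype_val).inter
    ((ContinuousMap.isOpen_setOfPred_mapsTo h0 isOpen_Iio).preimage continuous_subtype_val)

/-- Finitely many compact-open conditions satisfied by `f` are inherited by every `g` that agrees
with `f` on the union of their compact sets. -/
theorem mem_nhds_iff {f : CkTwo X} {s : Set (CkTwo X)} :
    s ∈ 𝓝 f ↔ ∃ K, IsCompact K ∧ {g : CkTwo X | EqOn g f K} ⊆ s := by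
  refine ⟨fun h => ?_, fun ⟨K, hK, h⟩ => Filter.mem_of_superset
    ((isOpen_eqOn f hK).mem_nhds fun _ _ => rfl) h⟩
  rw [nhds_subtype_eq_comap, Filter.mem_comap] at h
  obtain ⟨t, ht, hts⟩ := h
  obtain ⟨S, ⟨hSf, hS⟩, hSt⟩ := (ContinuousMap.hasBasis_nhds f.1).mem_iff.1 ht
  refine ⟨⋃ p ∈ S, p.1, hSf.isCompact_biUnion fun p hp => (hS p.1 p.2 hp).1, fun g hg => hts ?_⟩
  refine hSt ?_
  simp only [mem_iInter]
  intro p hp x hx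
  have : g x = f x := hg (mem_biUnion hp hx)
  change g x ∈ p.2
  rw [this]
  exact (hS p.1 p.2 hp).2.2 hx

theorem eqOn_mem_nhds (f : CkTwo X) {K : Set X} (hK : IsCompact K) :
    {g : CkTwo X | EqOn g f K} ∈ 𝓝 f :=
  mem_nhds_iff.2 ⟨K, hK, subset_rfl⟩

theorem isClopen_eqOn (f : CkTwo X) {K : Set X} (hK : IsCompact K) :
    IsClopen {g : CkTwo X | EqOn g f K} := by
  refine ⟨⟨isOpen_iff_mem_nhds.2 fun g hg => ?_⟩, isOpen_eqOn f hK⟩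
  exact Filter.mem_of_superset (eqOn_mem_nhds g hK) fun h hh hf => hg fun x hx =>
    (hh hx).symm.trans (hf hx)

theorem isZeroDimensional : IsZeroDimensional (CkTwo X) :=
  TopologicalSpace.isTopologicalBasis_of_isOpen_of_nhds (fun _ hU => hU.isOpen) fun f U hf hU => by
    obtain ⟨K, hK, hKU⟩ := mem_nhds_iff.1 (hU.mem_nhds hf)
    exact ⟨_, isClopen_eqOn f hK, fun _ _ => rfl, hKU⟩

theorem continuous_eval (x : X) : Continuous fun g : CkTwo X => g x :=
  (continuous_eval_const (F := C(X, ℝ)) x).comp continuous_subtype_val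

/-- Finitely many classes of functions agreeing on `K` cover a compact set, and each class contains
at most one `f i`. -/
theorem compactFinite_eqOn {ι : Type*} (f : ι → CkTwo X) {K : Set X} (hK : IsCompact K)
    (hf : ∀ i j, EqOn (f i) (f j) K → i = j) :
    CompactFinite fun i => {g : CkTwo X | EqOn g (f i) K} := by
  intro 𝒦 h𝒦
  obtain ⟨t, -, ht⟩ := h𝒦.elim_nhds_subcover (fun g => {h : CkTwo X | EqOn h g K})
    fun g _ => eqOn_mem_nhds g hK
  have hfin : (⋃ g ∈ t, {i | EqOn (f i) g K}).Finite := by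
    refine t.finite_toSet.biUnion fun g _ => Set.Subsingleton.finite fun i hi j hj => ?_
    exact hf i j (hi.trans hj.symm)
  refine hfin.subset ?_
  rintro i ⟨h, hh, hi⟩
  obtain ⟨g, hg, hhg⟩ := mem_iUnion₂.1 (ht hh)
  exact mem_biUnion hg ((EqOn.symm hi).trans hhg)

/-- The functions that vanish on `M₀` and are equal to one on `M₁`. -/
def constOn (M₀ M₁ : Set X) : Set (CkTwo X) :=
  {g | (∀ x ∈ M₀, g x = 0) ∧ ∀ x ∈ M₁, g x = 1}

theorem exists_mem_constOn {𝓜 : Set (Set X)} (h𝓜 : IsCompactNetwork 𝓜) (f : CkTwo X) {K : Set X}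
    (hK : IsCompact K) : ∃ M₀ ∈ 𝓜, ∃ M₁ ∈ 𝓜, f ∈ constOn M₀ M₁ ∧ K ⊆ M₀ ∪ M₁ := by
  have h1 := f.isClopen_fiber 1 (by simp)
  have h0 := f.isClopen_fiber 0 (by simp)
  obtain ⟨M₀, hM₀, h2, h3⟩ := h𝓜 _ _ h0.isOpen (hK.inter_right h0.1) inter_subset_right
  obtain ⟨M₁, hM₁, h4, h5⟩ := h𝓜 _ _ h1.isOpen (hK.inter_right h1.1) inter_subset_right
  refine ⟨M₀, hM₀, M₁, hM₁, ⟨fun x hx => h3 hx, fun x hx => h5 hx⟩, fun x hx => ?_⟩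
  rcases f.apply_eq_zero_or_one x with h | h
  · exact Or.inl (h2 ⟨hx, h⟩)
  · exact Or.inr (h4 ⟨hx, h⟩)

theorem eqOn_of_mem_constOn {M₀ M₁ : Set X} {f g : CkTwo X} (hf : f ∈ constOn M₀ M₁)
    (hg : g ∈ constOn M₀ M₁) : EqOn g f (M₀ ∪ M₁) := by
  rintro x (hx | hx)
  · rw [hf.1 x hx, hg.1 x hx]
  · rw [hf.2 x hx, hg.2 x hx]

theorem exists_countable_network {𝓜 : Set (Set X)} (hc : 𝓜.Countable) (h𝓜 : IsCompactNetwork 𝓜) :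
    ∃ 𝒩 : Set (Set (CkTwo X)), 𝒩.Countable ∧ IsNetwork 𝒩 := by
  refine ⟨_, hc.image2 hc constOn, fun f U hU hf => ?_⟩
  obtain ⟨K, hK, hKU⟩ := mem_nhds_iff.1 (hU.mem_nhds hf)
  obtain ⟨M₀, hM₀, M₁, hM₁, hfM, hKM⟩ := exists_mem_constOn h𝓜 f hK
  exact ⟨_, mem_image2_of_mem hM₀ hM₁, hfM, fun g hg =>
    hKU ((eqOn_of_mem_constOn hfM hg).mono hKM)⟩

theorem isCosmic {𝓜 : Set (Set X)} (hc : 𝓜.Countable) (h𝓜 : IsCompactNetwork 𝓜) :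
    IsCosmic (CkTwo X) :=
  ⟨inferInstance, exists_countable_network hc h𝓜⟩

theorem metrizableSpace_of_isHemicompact {𝓜 : Set (Set X)} (hc : 𝓜.Countable)
    (h𝓜 : IsCompactNetwork 𝓜) (hX : IsHemicompact X) :
    TopologicalSpace.MetrizableSpace (CkTwo X) := by
  obtain ⟨𝒦, h𝒦c, h𝒦, hcof⟩ := hX
  have : SecondCountableTopology (CkTwo X) := by
    refine secondCountableTopology_of_countable_network
      ((hc.prod hc).image2 h𝒦c fun p K => constOn (p.1 ∩ K) (p.2 ∩ K)) fun f U hU hf => ?_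
    obtain ⟨K, hK, hKU⟩ := mem_nhds_iff.1 (hU.mem_nhds hf)
    obtain ⟨L, hL, hKL⟩ := hcof K hK
    obtain ⟨M₀, hM₀, M₁, hM₁, hfM, hKM⟩ := exists_mem_constOn h𝓜 f (h𝒦 L hL)
    have hfL : f ∈ constOn (M₀ ∩ L) (M₁ ∩ L) :=
      ⟨fun x hx => hfM.1 x hx.1, fun x hx => hfM.2 x hx.1⟩
    -- The two traces cover `L`, so they prescribe all values on `L`; this makes the set open.
    have e : constOn (M₀ ∩ L) (M₁ ∩ L) = {g : CkTwo X | EqOn g f L} := by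
      ext g
      refine ⟨fun hg => (eqOn_of_mem_constOn hfL hg).mono ?_, fun hg => ⟨fun x hx => ?_,
        fun x hx => ?_⟩⟩
      · rw [← union_inter_distrib_right]
        exact subset_inter hKM subset_rfl
      · rw [hg hx.2, hfL.1 x hx]
      · rw [hg hx.2, hfL.2 x hx]
    refine ⟨_, mem_image2_of_mem (mk_mem_prod hM₀ hM₁) hL, ?_, hfL, ?_⟩
    · rw [e]; exact isOpen_eqOn f (h𝒦 L hL)
    · rw [e]; exact fun g hg => hKU (hg.mono hKL)
  infer_instance

/-- Restriction to a countable dense set is a continuous injection into a countable power of `ℝ`,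
hence an embedding of the compact set. -/
theorem secondCountableTopology_of_isCompact [TopologicalSpace.SeparableSpace X]
    {𝒦 : Set (CkTwo X)} (h𝒦 : IsCompact 𝒦) : SecondCountableTopology 𝒦 := by
  obtain ⟨D, hD, hDd⟩ := TopologicalSpace.exists_countable_dense X
  have : Countable D := hD.to_subtype
  have : CompactSpace 𝒦 := isCompact_iff_compactSpace.1 h𝒦
  let φ : 𝒦 → D → ℝ := fun g x => g.1 x.1
  have hφ : Continuous φ :=
    continuous_pi fun x => (continuous_eval x.1).comp continuous_subtype_val
  have hinj : Function.Injective φ := fun g h hgh => Subtype.ext (DFunLike.coe_injective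
    (g.1.continuous_coe.ext_on hDd h.1.continuous_coe fun x hx => congrFun hgh ⟨x, hx⟩))
  exact (hφ.isClosedEmbedding hinj).isEmbedding.secondCountableTopology

theorem sequentialSpace [TopologicalSpace.SeparableSpace X] [CompactlyCoherentSpace (CkTwo X)] :
    SequentialSpace (CkTwo X) where
  isClosed_of_seq A hA := by
    rw [CompactlyCoherentSpace.isClosed_iff]
    intro 𝒦 h𝒦
    have := secondCountableTopology_of_isCompact h𝒦
    exact (hA.preimage continuous_subtype_val.seqContinuous).isClosed

end CkTwo

/-! ### k-spaces, Ascoli spaces and strong fans -/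

theorem IsKOmegaSpace.compactlyCoherentSpace {Y : Type*} [TopologicalSpace Y]
    (h : IsKOmegaSpace Y) : CompactlyCoherentSpace Y := by
  obtain ⟨𝒦, -, h𝒦, -, hF⟩ := h
  exact .of_isClosed fun F h => (hF F).2 fun K hK => h K (h𝒦 K hK)

/-- The curried evaluation `Y → C(K, ℝ)` is continuous on compact sets, hence continuous;
compactness of `K` allows uncurrying. -/
theorem CompactlyCoherentSpace.isAscoli {Y : Type*} [TopologicalSpace Y] [T35Space Y]
    [CompactlyCoherentSpace Y] : IsAscoli Y := by
  refine ⟨inferInstance, fun K hK => ?_⟩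
  have : CompactSpace K := isCompact_iff_compactSpace.1 hK
  let ev : Y → C(K, ℝ) := fun y =>
    ⟨fun f => f.1 y, (continuous_eval_const y).comp continuous_subtype_val⟩
  have hev : Continuous ev := by
    rw [CompactlyCoherentSpace.isCoherentWith.continuous_iff]
    intro C hC
    rw [continuousOn_iff_continuous_domRestrict]
    have : CompactSpace C := isCompact_iff_compactSpace.1 hC
    refine ContinuousMap.continuous_of_continuous_uncurry _ ?_
    have h1 : Continuous fun p : C × K => (p.2.1.restrict C) p.1 :=
      (((ContinuousMap.continuous_restrict C).comp continuous_subtype_val).comp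
        continuous_snd).eval continuous_fst
    exact h1
  have h2 := ContinuousMap.continuous_uncurry_of_continuous ⟨ev, hev⟩
  exact h2.comp continuous_swap

theorem exists_continuous_one_of_finite {Y : Type*} [TopologicalSpace Y] {F U : Set Y}
    (hF : F.Finite) (hFU : F ⊆ U) (hU : IsROpen U) :
    ∃ g : C(Y, unitInterval), (∀ y ∈ F, g y = 1) ∧ ∀ y ∉ U, g y = 0 := by
  induction F, hF using Set.Finite.induction_on with
  | empty => exact ⟨ContinuousMap.const Y 0, by simp, fun _ _ => rfl⟩
  | @insert a s _ _ ih =>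
    obtain ⟨g, hg1, hg0⟩ := ih ((subset_insert _ _).trans hFU)
    obtain ⟨f, hf1, hf0⟩ := hU a (hFU (mem_insert _ _))
    refine ⟨f ⊔ g, fun y hy => ?_, fun y hy => ?_⟩
    · rw [ContinuousMap.sup_apply]
      rcases hy with rfl | hy
      · rw [hf1]; exact sup_eq_left.2 unitInterval.le_one'
      · rw [hg1 y hy]; exact sup_eq_right.2 unitInterval.le_one'
    · rw [ContinuousMap.sup_apply, hf0 y hy, hg0 y hy, sup_idem]

/-- Functions equal to 1 on `F n` and 0 off `U n` tend to 0 in the compact-open topology. Even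
continuity at `(0, y)` gives a neighborhood of `y` on which almost all of them are below 1, so it
misses almost all `F n`. -/
theorem IsAscoli.not_containsStrongFinOmegaFan {Y : Type*} [TopologicalSpace Y] (hY : IsAscoli Y) :
    ¬ ContainsStrongFinOmegaFan Y := by
  rintro ⟨F, hF, ⟨-, hFl⟩, U, hU, hUc⟩
  choose g hg1 hg0 using fun n => exists_continuous_one_of_finite (hF n) (hU n).2 (hU n).1
  let φ : C(unitInterval, ℝ) := ⟨Subtype.val, continuous_subtype_val⟩
  let f : ℕ → C(Y, ℝ) := fun n => φ.comp (g n)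
  have hf : Filter.Tendsto f Filter.atTop (𝓝 0) := by
    rw [ContinuousMap.tendsto_nhds_compactOpen]
    intro K hK V hV h0
    have hfin := hUc K hK
    rw [← Nat.cofinite_eq_atTop]
    filter_upwards [hfin.compl_mem_cofinite] with n hn x hx
    have hxU : x ∉ U n := fun h => hn ⟨x, hx, h⟩
    have : f n x = (0 : C(Y, ℝ)) x := by
      simp [f, φ, hg0 n x hxU]
    rw [this]
    exact h0 hx
  have hcont := hY.2 _ hf.isCompact_insert_range
  refine hFl fun y => ?_
  have h1 := hcont.continuousAt (x := (⟨0, mem_insert _ _⟩, y))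
  have h2 : Iio (1 : ℝ) ∈ 𝓝 ((0 : C(Y, ℝ)) y) := Iio_mem_nhds (by simp)
  obtain ⟨V, hV, W, hW, hVW⟩ := mem_nhds_prod_iff.1 (h1 h2)
  refine ⟨W, hW, ?_⟩
  rw [nhds_subtype_eq_comap, Filter.mem_comap] at hV
  obtain ⟨V', hV', hVV⟩ := hV
  have h3 := hf hV'
  rw [← Nat.cofinite_eq_atTop] at h3
  refine (Filter.mem_cofinite.1 h3).subset ?_
  rintro n ⟨z, hzF, hzW⟩ hn
  have h4 : f n z < 1 := hVW (show ((⟨f n, mem_insert_of_mem _ (mem_range_self n)⟩, z) :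
    (insert (0 : C(Y, ℝ)) (range f) : Set _) × Y) ∈ V ×ˢ W from ⟨hVV hn, hzW⟩)
  simp [f, φ, hg1 n z hzF] at h4

/-! ### The k_ω-property when the non-isolated points form a compact set -/

namespace CkTwo

variable {X : Type*} [TopologicalSpace X]

/-- The functions that agree with `h` on an open set whose complement consists of isolated points
form a compact set. -/
theorem isCompact_eqOn (h : CkTwo X) {V : Set X} (hV : IsOpen V)
    (hiso : ∀ x ∉ V, IsOpen ({x} : Set X)) : IsCompact {g : CkTwo X | EqOn g h V} := by
  classical
  have hVc : ∀ S ⊆ Vᶜ, IsOpen S := fun S hS => by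
    rw [← biUnion_of_singleton S]
    exact isOpen_biUnion fun x hx => hiso x (hS hx)
  have hW : ∀ s : X → Bool, IsClopen ((V ∩ {x | h x = 1}) ∪ (Vᶜ ∩ {x | s x = true})) := fun s => by
    refine ⟨⟨?_⟩, (hV.inter (h.isClopen_fiber 1 (by simp)).isOpen).union
      (hVc _ inter_subset_left)⟩
    have e : ((V ∩ {x | h x = 1}) ∪ (Vᶜ ∩ {x | s x = true}))ᶜ =
        (V ∩ {x | h x = 1}ᶜ) ∪ (Vᶜ ∩ {x | s x = true}ᶜ) := by
      ext x
      simp only [mem_compl_iff, mem_union, mem_inter_iff, not_or, not_and]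
      tauto
    rw [e]
    exact (hV.inter (h.isClopen_fiber 1 (by simp)).compl.isOpen).union (hVc _ inter_subset_left)
  -- The set is the image of a Cantor cube: values off `V` are arbitrary, and continuity holds
  -- because a compact set has only finitely many points off `V`.
  let Φ : (X → Bool) → CkTwo X := fun s => ind _ (hW s)
  have hΦV : ∀ s, EqOn (Φ s) h V := fun s x hx => by
    rcases h.apply_eq_zero_or_one x with hx0 | hx1
    · rw [hx0]; exact ind_of_notMem _ (by simp [hx, hx0])
    · rw [hx1]; exact ind_of_mem _ (Or.inl ⟨hx, hx1⟩)
  have hΦc : ∀ s s' x, s x = s' x → Φ s x = Φ s' x := fun s s' x hs => by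
    by_cases hx : x ∈ V
    · rw [hΦV s hx, hΦV s' hx]
    · cases hsx : s' x
      · exact (ind_of_notMem (hW s) (by simp [hx, hs, hsx])).trans
          (ind_of_notMem (hW s') (by simp [hx, hsx])).symm
      · exact (ind_of_mem (hW s) (Or.inr ⟨hx, hs.trans hsx⟩)).trans
          (ind_of_mem (hW s') (Or.inr ⟨hx, hsx⟩)).symm
  have hΦ : Continuous Φ := by
    refine continuous_iff_continuousAt.2 fun s => ?_
    intro T hT
    obtain ⟨K, hK, hKT⟩ := mem_nhds_iff.1 hT
    have hfin : (K \ V).Finite := by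
      refine (hK.diff hV).finite (isDiscrete_iff_forall_mem_exists_isOpen.2 fun x hx => ?_)
      refine ⟨{x}, hiso x hx.2, ?_⟩
      ext y
      simp only [mem_inter_iff, mem_singleton_iff]
      exact ⟨fun h => h.1, fun h => ⟨h, h ▸ hx⟩⟩
    have hn : {s' : X → Bool | ∀ x ∈ K \ V, s' x = s x} ∈ 𝓝 s := by
      have : {s' : X → Bool | ∀ x ∈ K \ V, s' x = s x} = (K \ V).pi fun x => {s x} := by
        ext s'
        simp [Set.mem_pi]
      rw [this]
      exact set_pi_mem_nhds hfin fun x _ => by simp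
    change Φ ⁻¹' T ∈ 𝓝 s
    refine Filter.mem_of_superset hn fun s' hs' => hKT fun x hx => ?_
    by_cases hxV : x ∈ V
    · rw [hΦV s' hxV, hΦV s hxV]
    · exact hΦc _ _ x (hs' x ⟨hx, hxV⟩)
  have : {g : CkTwo X | EqOn g h V} = range Φ := by
    ext g
    refine ⟨fun hg => ⟨fun x => decide (g x = 1), ?_⟩, ?_⟩
    · refine DFunLike.coe_injective (funext fun x => ?_)
      by_cases hx : x ∈ V
      · rw [hΦV _ hx, hg hx]
      · rcases g.apply_eq_zero_or_one x with h0 | h1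
        · rw [h0]; exact ind_of_notMem _ (by simp [hx, h0])
        · rw [h1]; exact ind_of_mem _ (Or.inr ⟨hx, by simp [h1]⟩)
    · rintro ⟨s, rfl⟩
      exact hΦV s
  rw [this]
  exact isCompact_range hΦ

/-- A compact set of functions all of which differ from `f` somewhere on `V` is separated from `f`
by a finite subset of `V`. -/
theorem exists_finite_of_isCompact (f : CkTwo X) {V : Set X} {L : Set (CkTwo X)} (hL : IsCompact L)
    (hV : ∀ g ∈ L, ¬ EqOn g f V) : ∃ E ⊆ V, E.Finite ∧ ∀ g ∈ L, ¬ EqOn g f E := by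
  classical
  have hx : ∀ g : L, ∃ x ∈ V, g.1 x ≠ f x := fun g => by
    have := hV g.1 g.2
    simpa [EqOn] using this
  choose x hxV hx using hx
  obtain ⟨t, ht⟩ := hL.elim_nhds_subcover' (fun g hg => {h | EqOn h g {x ⟨g, hg⟩}})
    fun g _ => eqOn_mem_nhds g isCompact_singleton
  refine ⟨x '' t, ?_, t.finite_toSet.image x, fun g hg hgf => ?_⟩
  · rintro _ ⟨g, -, rfl⟩
    exact hxV g
  · obtain ⟨h, hh, hgh⟩ := mem_iUnion₂.1 (ht hg)
    have h1 : g (x h) = h.1 (x h) := hgh rfl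
    exact hx h (h1.symm.trans (hgf (mem_image_of_mem x hh)))

/-- A set of functions is closed at `f` if it has closed trace on each set of functions that agree
with `f` on a member of a neighborhood base of a compact set with isolated complement. -/
theorem exists_isCompact_separating (f : CkTwo X) {C : Set X} (hC : IsCompact C) {V : ℕ → Set X}
    (hVanti : Antitone V) (hVC : ∀ U, IsOpen U → C ⊆ U → ∃ n, V n ⊆ U)
    {F : Set (CkTwo X)} (hf : f ∉ F) (hF : ∀ n, IsCompact (F ∩ {g | EqOn g f (V n)})) :
    ∃ K, IsCompact K ∧ ∀ g ∈ F, ¬ EqOn g f K := by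
  classical
  -- The finite set `T` separates `f` from the members of `F` agreeing with `f` on `V n`. Passing to
  -- `n + 1` needs new points only inside `V n`, so the union of all stages accumulates only at `C`
  -- and is compact together with it.
  let Good : ℕ → Set X → Prop := fun n T =>
    T.Finite ∧ ∀ g ∈ F, EqOn g f (V n) → ¬ EqOn g f T
  have hbase : ∃ T, Good 0 T := by
    obtain ⟨E, -, hE, h⟩ := exists_finite_of_isCompact f (V := univ) (hF 0) fun g hg he =>
      hf (by
        have : g = f := DFunLike.coe_injective (funext fun x => he (mem_univ x))
        exact this ▸ hg.1)
    exact ⟨E, hE, fun g hg hgV => h g ⟨hg, hgV⟩⟩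
  have hstep : ∀ n T, Good n T → ∃ T', Good (n + 1) T' ∧ T ⊆ T' ∧ T' \ T ⊆ V n := by
    intro n T hT
    obtain ⟨E, hEV, hE, h⟩ := exists_finite_of_isCompact f (V := V n)
      ((hF (n + 1)).inter_right (isClopen_eqOn f hT.1.isCompact).1) fun g hg he =>
        hT.2 g hg.1.1 he hg.2
    refine ⟨T ∪ E, ⟨hT.1.union hE, fun g hg hgV hgT => ?_⟩, subset_union_left, ?_⟩
    · exact h g ⟨⟨hg, hgV⟩, hgT.mono subset_union_left⟩ (hgT.mono subset_union_right)
    · rintro x ⟨hx | hx, hxT⟩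
      · exact absurd hx hxT
      · exact hEV hx
  obtain ⟨T₀, hT₀⟩ := hbase
  choose! next hnext using hstep
  let T : ℕ → Set X := fun n => Nat.rec T₀ (fun n T => next n T) n
  have hT : ∀ n, Good n (T n) := fun n => by
    induction n with
    | zero => exact hT₀
    | succ n ih => exact (hnext n _ ih).1
  have hsub : ∀ n k, T (n + k) ⊆ T n ∪ V n := fun n k => by
    induction k with
    | zero => exact subset_union_left
    | succ k ih =>
      intro x hx
      by_cases hxT : x ∈ T (n + k)
      · exact ih hxT
      · exact Or.inr (hVanti (Nat.le_add_right n k) ((hnext (n + k) _ (hT _)).2.2 ⟨hx, hxT⟩))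
  have hmono : Monotone T := monotone_nat_of_le_succ fun n => (hnext n _ (hT n)).2.1
  refine ⟨C ∪ ⋃ n, T n, hC.union_of_finite_diff fun U hU hCU => ?_, fun g hg hgK => ?_⟩
  · obtain ⟨n, hn⟩ := hVC U hU hCU
    refine (hT n).1.subset ?_
    rintro x ⟨hx, hxU⟩
    obtain ⟨m, hm⟩ := mem_iUnion.1 hx
    rcases hsub n m (hmono (Nat.le_add_left m n) hm) with h | h
    · exact h
    · exact absurd (hn h) hxU
  · obtain ⟨n, hn⟩ := hVC _ (isOpen_eq g f) (hgK.mono subset_union_left)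
    exact (hT n).2 g hg hn (hgK.mono ((subset_iUnion T n).trans subset_union_right))

theorem isKOmegaSpace {𝓜 : Set (Set X)} (hc : 𝓜.Countable) (h𝓜 : IsCompactNetwork 𝓜)
    [TopologicalSpace.MetrizableSpace X] (hX : IsCompact (nonIsolatedPoints X)) :
    IsKOmegaSpace (CkTwo X) := by
  classical
  let _ := TopologicalSpace.metrizableSpaceMetric X
  set C := nonIsolatedPoints X with hCdef
  let V : ℕ → Set X := fun n => Metric.thickening (1 / ((n : ℝ) + 1)) C
  have hVanti : Antitone V := fun m n hmn =>
    Metric.thickening_mono (one_div_le_one_div_of_le (by positivity) (by gcongr)) C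
  have hCV : ∀ n, C ⊆ V n := fun n => Metric.self_subset_thickening (by positivity) C
  have hVC : ∀ U, IsOpen U → C ⊆ U → ∃ n, V n ⊆ U := fun U hU hCU => by
    obtain ⟨δ, hδ, h⟩ := hX.exists_thickening_subset_open hU hCU
    obtain ⟨n, hn⟩ := exists_nat_one_div_lt hδ
    exact ⟨n, (Metric.thickening_mono hn.le C).trans h⟩
  have hVo : ∀ n, IsOpen (V n) := fun n => Metric.isOpen_thickening
  have hiso : ∀ n, ∀ x ∉ V n, IsOpen ({x} : Set X) := fun n x hx => by
    by_contra h
    exact hx (hCV n h)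
  have hL : ∀ (h : CkTwo X) n, IsCompact {g : CkTwo X | EqOn g h (V n)} := fun h n =>
    isCompact_eqOn h (hVo n) (hiso n)
  -- One representative per pair from `𝓜` keeps the family countable; for an empty `constOn` the
  -- choice is irrelevant.
  have hrep : ∀ p : Set X × Set X, ∃ h : CkTwo X, (constOn p.1 p.2).Nonempty → h ∈ constOn p.1 p.2 :=
    fun p => by
      by_cases hp : (constOn p.1 p.2).Nonempty
      · exact ⟨hp.some, fun _ => hp.some_mem⟩
      · exact ⟨ind ∅ isClopen_empty, fun h => absurd h hp⟩
  choose rep hrep using hrep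
  have hex : ∀ f : CkTwo X, ∃ p ∈ 𝓜 ×ˢ 𝓜, ∃ n, EqOn (rep p) f (V n) := fun f => by
    obtain ⟨M₀, hM₀, M₁, hM₁, hf, hCM⟩ := exists_mem_constOn h𝓜 f hX
    have h1 := (eqOn_of_mem_constOn hf (hrep (M₀, M₁) ⟨f, hf⟩)).mono hCM
    obtain ⟨n, hn⟩ := hVC _ (isOpen_eq _ f) h1
    exact ⟨(M₀, M₁), ⟨hM₀, hM₁⟩, n, hn⟩
  refine ⟨image2 (fun p n => ({g | EqOn g (rep p) (V n)} : Set (CkTwo X))) (𝓜 ×ˢ 𝓜) univ,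
    (hc.prod hc).image2 countable_univ _, ?_, ?_, fun F => ⟨fun hF K _ => hF.preimage continuous_subtype_val, fun hF => ?_⟩⟩
  · rintro _ ⟨p, -, n, -, rfl⟩
    exact hL _ _
  · refine eq_univ_of_forall fun f => ?_
    obtain ⟨p, hp, n, hn⟩ := hex f
    exact ⟨_, mem_image2_of_mem hp (mem_univ n), hn.symm⟩
  · refine ⟨isOpen_iff_mem_nhds.2 fun f hf => ?_⟩
    obtain ⟨p, hp, m, hm⟩ := hex f
    have hcpt : ∀ n, IsCompact (F ∩ {g | EqOn g f (V (n + m))}) := fun n => by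
      have e : {g : CkTwo X | EqOn g f (V (n + m))} = {g : CkTwo X | EqOn g (rep p) (V (n + m))} := by
        have := hm.mono (hVanti (Nat.le_add_left m n))
        ext g
        exact ⟨fun h => h.trans this.symm, fun h => h.trans this⟩
      rw [e, inter_comm]
      have h1 := hF _ (mem_image2_of_mem hp (mem_univ (n + m)))
      obtain ⟨F', hF', hFF⟩ := isClosed_induced_iff.1 h1
      rw [← Subtype.image_preimage_coe, ← hFF, Subtype.image_preimage_coe]
      exact (hL _ _).inter_right hF'
    obtain ⟨K, hK, hKF⟩ := exists_isCompact_separating f hX (V := fun n => V (n + m))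
      (fun a b hab => hVanti (by lia)) (fun U hU hCU => by
        obtain ⟨n, hn⟩ := hVC U hU hCU
        exact ⟨n, (hVanti (by lia)).trans hn⟩) hf hcpt
    exact mem_nhds_iff.2 ⟨K, hK, fun g hg hgF => hKF g hgF hg⟩

end CkTwo

/-! ### Strong fans over a space that is not hemicompact -/

theorem isClosed_nonIsolatedPoints (X : Type*) [TopologicalSpace X] :
    IsClosed (nonIsolatedPoints X) := by
  refine ⟨isOpen_iff_mem_nhds.2 fun x hx => ?_⟩
  have hx' : IsOpen ({x} : Set X) := not_not.1 hx
  refine Filter.mem_of_superset (hx'.mem_nhds rfl) ?_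
  rintro y rfl
  exact hx

theorem isOpen_of_forall_isOpen_singleton {X : Type*} [TopologicalSpace X] {S : Set X}
    (h : ∀ x ∈ S, IsOpen ({x} : Set X)) : IsOpen S := by
  rw [← biUnion_of_singleton S]
  exact isOpen_biUnion h

theorem Set.Countable.exists_injective_range_eq {α : Type*} {s : Set α} (hc : s.Countable)
    (hi : s.Infinite) : ∃ a : ℕ → α, Function.Injective a ∧ range a = s := by
  have := hc.to_subtype
  have := hi.to_subtype
  obtain ⟨e⟩ := nonempty_denumerable s
  refine ⟨fun n => (Denumerable.eqv s).symm n,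
    Subtype.val_injective.comp (Denumerable.eqv s).symm.injective, ?_⟩
  ext x
  exact ⟨fun ⟨n, hn⟩ => hn ▸ ((Denumerable.eqv s).symm n).2,
    fun hx => ⟨Denumerable.eqv s ⟨x, hx⟩, by simp⟩⟩

/-- In a non-hemicompact space with a countable compact network, arbitrarily large compact sets are
limits of decreasing sequences of noncompact closed sets. -/
theorem exists_noncompact_seq {X : Type*} [TopologicalSpace X] [RegularSpace X] {𝓜 : Set (Set X)}
    (hc : 𝓜.Countable) (h𝓜 : IsCompactNetwork 𝓜) (hX : ¬ IsHemicompact X) {K : Set X}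
    (hK : IsCompact K) :
    ∃ C, IsCompact C ∧ K ⊆ C ∧ ∃ N : ℕ → Set X, Antitone N ∧ (∀ n, IsClosed (N n)) ∧
      (∀ n, ¬ IsCompact (N n)) ∧ ∀ V, IsOpen V → C ⊆ V → ∃ n, N n ⊆ V := by
  have hcl := h𝓜.image_closure
  set 𝓝c := closure '' 𝓜
  have hcc : 𝓝c.Countable := hc.image _
  by_contra! hcon
  -- Otherwise, for each compact `B`, some finite intersection of closed network members containing
  -- `B ∪ K` is compact; there are only countably many such intersections.
  refine hX ⟨{L | IsCompact L ∧ ∃ ℱ : Set (Set X), (ℱ.Finite ∧ ℱ ⊆ 𝓝c) ∧ ⋂₀ ℱ = L}, ?_,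
    fun L hL => hL.1, fun B hB => ?_⟩
  · exact ((countable_ofPred_finite_subset hcc).image sInter).mono fun L hL => hL.2
  · have hne : {M ∈ 𝓝c | B ∪ K ⊆ M}.Nonempty := by
      obtain ⟨M, hM, h, -⟩ := hcl univ (B ∪ K) isOpen_univ (hB.union hK) (subset_univ _)
      exact ⟨M, hM, h⟩
    obtain ⟨u, hu⟩ := (hcc.mono (sep_subset 𝓝c fun M => B ∪ K ⊆ M)).exists_eq_range hne
    have hmem : ∀ i, u i ∈ 𝓝c ∧ B ∪ K ⊆ u i := fun i => hu.ge (mem_range_self i)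
    have huc : ∀ i, IsClosed (u i) := fun i => by
      obtain ⟨M, -, hM⟩ := (hmem i).1
      rw [← hM]
      exact isClosed_closure
    have hN : ∃ n, IsCompact (⋂₀ (u '' Iic n)) := by
      by_contra! hnc
      obtain ⟨V, hV, hBV, hVn⟩ := hcon (B ∪ K) (hB.union hK) subset_union_right
        (fun n => ⋂₀ (u '' Iic n))
        (fun m n hmn => sInter_subset_sInter (image_mono (Iic_subset_Iic.2 hmn)))
        (fun n => isClosed_sInter (by rintro _ ⟨i, -, rfl⟩; exact huc i)) hnc
      obtain ⟨M, hM, h1, h2⟩ := hcl V _ hV (hB.union hK) hBV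
      obtain ⟨n, hn⟩ := hu.le (show M ∈ {M ∈ 𝓝c | B ∪ K ⊆ M} from ⟨hM, h1⟩)
      exact hVn n ((sInter_subset_of_mem (mem_image_of_mem u (mem_Iic.2 le_rfl))).trans
        (hn.le.trans h2))
    obtain ⟨n, hn⟩ := hN
    refine ⟨_, ⟨hn, u '' Iic n, ⟨(finite_Iic n).image u, ?_⟩, rfl⟩, ?_⟩
    · rintro _ ⟨i, -, rfl⟩
      exact (hmem i).1
    · refine subset_sInter ?_
      rintro _ ⟨i, -, rfl⟩
      exact subset_union_left.trans (hmem i).2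

namespace CkTwo

variable {X : Type*} [TopologicalSpace X]

theorem isROpen_of_isOpen {U : Set (CkTwo X)} (hU : IsOpen U) : IsROpen U := by
  intro g hg
  obtain ⟨φ, hφ, h0, h1⟩ := CompletelyRegularSpace.completely_regular g Uᶜ hU.isClosed_compl
    (fun h => h hg)
  exact ⟨⟨fun y => unitInterval.symm (φ y), unitInterval.continuous_symm.comp hφ⟩, by simp [h0],
    fun y hy => by simp [h1 hy]⟩

/-- Points converging to a compact set `C` and functions vanishing on `C` but not at these points
give a fan as soon as the functions with fixed first index have compact-finite neighborhoods. -/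
theorem containsStrongFinOmegaFan_of_seq {C : Set X} (hC : IsCompact C) (d : ℕ → ℕ → X)
    (hd : ∀ V, IsOpen V → C ⊆ V → ∀ᶠ n in Filter.atTop, ∀ m, d n m ∈ V) (f : ℕ → ℕ → CkTwo X)
    (U : ℕ → ℕ → Set (CkTwo X)) (hUo : ∀ n m, IsOpen (U n m)) (hfU : ∀ n m, f n m ∈ U n m)
    (hfC : ∀ n m, ∀ x ∈ C, f n m x = 0) (hfd : ∀ n m, f n m (d n m) = 1)
    (hUc : ∀ n, CompactFinite (U n))
    (hsmall : ∀ B, IsCompact B → ∃ᶠ n in Filter.atTop, ∃ m, ∀ x ∈ B, f n m x = 0) :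
    ContainsStrongFinOmegaFan (CkTwo X) := by
  classical
  let U' : ℕ × ℕ → Set (CkTwo X) := fun p =>
    U p.1 p.2 ∩ {g | EqOn g (f p.1 p.2) (insert (d p.1 p.2) C)}
  have hfU' : ∀ p, f p.1 p.2 ∈ U' p := fun p => ⟨hfU _ _, fun _ _ => rfl⟩
  have hU'o : ∀ p, IsOpen (U' p) := fun p => (hUo _ _).inter (isOpen_eqOn _ (hC.insert _))
  have hU'c : CompactFinite U' := by
    intro 𝒦 h𝒦
    by_contra hinf
    set S := {p | (𝒦 ∩ U' p).Nonempty} with hS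
    -- Each fixed `n` contributes finitely many pairs by `hUc`, so infinitely many values of `n`
    -- must occur.
    have hN : (Prod.fst '' S).Infinite := fun hfin => by
      refine hinf ((hfin.biUnion (t := fun n => Prod.mk n '' {m | (𝒦 ∩ U n m).Nonempty})
        fun n _ => (hUc n 𝒦 h𝒦).image _).subset fun p hp => ?_)
      exact mem_biUnion (mem_image_of_mem _ hp)
        ⟨p.2, hp.mono (inter_subset_inter_right _ inter_subset_left), rfl⟩
    have hex : ∀ n ∈ Prod.fst '' S, ∃ m, ∃ g ∈ 𝒦, (∀ x ∈ C, g x = 0) ∧ g (d n m) = 1 := by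
      rintro _ ⟨⟨n, m⟩, ⟨g, hg, -, hgf⟩, rfl⟩
      exact ⟨m, g, hg, fun x hx => (hgf (mem_insert_of_mem _ hx)).trans (hfC n m x hx),
        (hgf (mem_insert _ _)).trans (hfd n m)⟩
    have : Inhabited (CkTwo X) := ⟨f 0 0⟩
    choose! m g hg hgC hgd using hex
    set D := (fun n => d n (m n)) '' (Prod.fst '' S) with hD
    have hB : IsCompact (C ∪ D) := by
      refine hC.union_of_finite_diff fun V hV hCV => ?_
      obtain ⟨n₀, hn₀⟩ := Filter.eventually_atTop.1 (hd V hV hCV)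
      refine ((finite_Iio n₀).image fun n => d n (m n)).subset ?_
      rintro _ ⟨⟨n, -, rfl⟩, hnV⟩
      refine mem_image_of_mem _ (mem_Iio.2 ?_)
      by_contra hlt
      exact hnV (hn₀ n (not_lt.1 hlt) _)
    obtain ⟨t, -, ht⟩ := h𝒦.elim_nhds_subcover (fun h => {g : CkTwo X | EqOn g h (C ∪ D)})
      fun h _ => eqOn_mem_nhds h hB
    -- Infinitely many of the `g n` agree with a single `h` on `C ∪ D`. Then `h` vanishes near `C`,
    -- hence at the late markers, where `g n` is 1.
    obtain ⟨h, -, hh⟩ : ∃ h ∈ t, {n ∈ Prod.fst '' S | EqOn (g n) h (C ∪ D)}.Infinite := by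
      by_contra! hcon
      refine hN ((t.finite_toSet.biUnion fun h hh => hcon h hh).subset
        fun n hn => ?_)
      obtain ⟨h, hht, hgh⟩ := mem_iUnion₂.1 (ht (hg n hn))
      exact mem_biUnion hht ⟨hn, hgh⟩
    obtain ⟨n₁, hn₁, hn₁h⟩ := hh.nonempty
    have hhC : C ⊆ {x | h x = 0} := fun x hx =>
      (hn₁h (Or.inl hx)).symm.trans (hgC n₁ hn₁ x hx)
    obtain ⟨n₀, hn₀⟩ := Filter.eventually_atTop.1
      (hd _ (h.isClopen_fiber 0 (by simp)).isOpen hhC)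
    obtain ⟨n, ⟨hn, hnh⟩, hlt⟩ := hh.exists_gt n₀
    have h1 : g n (d n (m n)) = h (d n (m n)) := hnh (Or.inr (mem_image_of_mem _ hn))
    have h2 : h (d n (m n)) = 0 := hn₀ n hlt.le _
    rw [hgd n hn, h2] at h1
    exact one_ne_zero h1
  have hcf := hU'c.comp_injective Nat.pairEquiv.symm.injective
  refine ⟨fun i => {f (Nat.pairEquiv.symm i).1 (Nat.pairEquiv.symm i).2},
    fun i => finite_singleton _, ⟨hcf.mono fun i => singleton_subset_iff.2 (hfU' _), fun hlf => ?_⟩,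
    fun i => U' (Nat.pairEquiv.symm i), fun i => ⟨isROpen_of_isOpen (hU'o _),
      singleton_subset_iff.2 (hfU' _)⟩, hcf⟩
  -- Local finiteness fails at the zero function.
  obtain ⟨T, hT, hTf⟩ := hlf (ind ∅ isClopen_empty)
  obtain ⟨B, hB, hBT⟩ := mem_nhds_iff.1 hT
  refine Nat.frequently_atTop_iff_infinite.1 (hsmall B hB)
    ((hTf.image fun i => (Nat.pairEquiv.symm i).1).subset ?_)
  rintro n ⟨m, hm⟩
  refine ⟨Nat.pairEquiv (n, m), ⟨f n m, by simp, hBT fun x hx => ?_⟩, by simp⟩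
  rw [hm x hx]
  exact (ind_of_notMem _ (notMem_empty x)).symm

/-- Adds the markers: it suffices to find dispersed `e n m` vanishing on `C`. Each is raised to 1 on
a clopen piece around a point of a late `N`, off `C ∪ P n ∪ L n`; the pieces leave every compact set
as `m` grows, so smallness on `B` survives. -/
theorem containsStrongFinOmegaFan_of_noncompact_seq [LindelofSpace X] (hX : IsZeroDimensional X)
    {C : Set X} (hC : IsCompact C) {N : ℕ → Set X} (hNa : Antitone N) (hNc : ∀ n, IsClosed (N n))
    (hN : ∀ n, ¬ IsCompact (N n)) (hNV : ∀ V, IsOpen V → C ⊆ V → ∃ n, N n ⊆ V)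
    {P : ℕ → Set X} (hP : ∀ n, IsClopen (P n)) (hPC : ∀ n, Disjoint (P n) C)
    {L : ℕ → Set X} (hL : ∀ n, IsCompact (L n)) {e : ℕ → ℕ → CkTwo X}
    {U : ℕ → ℕ → Set (CkTwo X)} (hUo : ∀ n m, IsOpen (U n m))
    (hU : ∀ n m (f : CkTwo X), (∀ x, e n m x = 1 → f x = 1) →
      EqOn f (e n m) (C ∪ P n ∪ L n) → f ∈ U n m)
    (heC : ∀ n m, ∀ x ∈ C, e n m x = 0) (hUc : ∀ n, CompactFinite (U n))
    (hsmall : ∀ B, IsCompact B →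
      ∃ᶠ n in Filter.atTop, ∃ᶠ m in Filter.atTop, ∀ x ∈ B, e n m x = 0) :
    ContainsStrongFinOmegaFan (CkTwo X) := by
  -- The index is late enough for the markers to avoid `P n`, and at least `n` so that they converge
  -- to `C`.
  have hs : ∀ n, ∃ s ≥ n, N s ⊆ (P n)ᶜ := fun n => by
    obtain ⟨k, hk⟩ := hNV (P n)ᶜ (hP n).compl.isOpen (hPC n).symm.subset_compl_right
    exact ⟨max n k, le_max_left _ _, (hNa (le_max_right n k)).trans hk⟩
  choose s hsn hsP using hs
  choose W hW hWC hWN hWd hWf using fun n =>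
    hX.exists_clopen_seq (hNc (s n)) (hN (s n)) (hC.union (hL n))
  choose d hdW hdN using hWN
  have hcl : ∀ n m, IsClopen ({x | e n m x = 1} ∪ (W n m \ P n)) := fun n m =>
    ((e n m).isClopen_fiber 1 (by simp)).union ((hW n m).diff (hP n))
  have hf1 : ∀ n m x, e n m x = 1 → ind _ (hcl n m) x = 1 := fun n m x hx =>
    ind_of_mem _ (Or.inl hx)
  have hf : ∀ n m x, x ∉ W n m \ P n → ind _ (hcl n m) x = e n m x := fun n m x hx => by
    rcases (e n m).apply_eq_zero_or_one x with h | h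
    · rw [h]
      exact ind_of_notMem _ (by simpa [h] using hx)
    · rw [h, hf1 n m x h]
  have hfY : ∀ n m, EqOn (ind _ (hcl n m)) (e n m) (C ∪ P n ∪ L n) := by
    rintro n m x ((hx | hx) | hx)
    · exact hf n m x fun h => (hWC n m).notMem_of_mem_left h.1 (Or.inl hx)
    · exact hf n m x fun h => h.2 hx
    · exact hf n m x fun h => (hWC n m).notMem_of_mem_left h.1 (Or.inr hx)
  refine containsStrongFinOmegaFan_of_seq hC d (fun V hV hCV => ?_) (fun n m => ind _ (hcl n m)) U
    hUo (fun n m => hU n m _ (hf1 n m) (hfY n m))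
    (fun n m x hx => (hfY n m (Or.inl (Or.inl hx))).trans (heC n m x hx))
    (fun n m => ind_of_mem _ (Or.inr ⟨hdW n m, hsP n (hdN n m)⟩)) hUc fun B hB => ?_
  · obtain ⟨k, hk⟩ := hNV V hV hCV
    filter_upwards [Filter.eventually_ge_atTop k] with n hn m
    exact hk (hNa (hn.trans (hsn n)) (hdN n m))
  · refine (hsmall B hB).mono fun n hn => ?_
    have h1 : ∀ᶠ m in Filter.atTop, ¬ (B ∩ W n m).Nonempty := by
      rw [← Nat.cofinite_eq_atTop]
      exact (hWf n B hB).compl_mem_cofinite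
    obtain ⟨m, hm0, hm⟩ := (hn.and_eventually h1).exists
    exact ⟨m, fun x hx => (hf n m x fun h => hm ⟨x, hx, h.1⟩).trans (hm0 x hx)⟩

/-- By compactness, indicators of small clopen neighborhoods of `p` would produce the indicator of
`{p}` as a continuous function, making `p` isolated. -/
theorem not_isCompact_vanishing [T1Space X] (hX : IsZeroDimensional X) {P : Set X} (hP : IsOpen P)
    {p : X} (hp : p ∈ P) (hpn : ¬ IsOpen ({p} : Set X)) :
    ¬ IsCompact {g : CkTwo X | ∀ x ∉ P, g x = 0} := by
  intro hc
  have h1 : IsCompact ({g : CkTwo X | ∀ x ∉ P, g x = 0} ∩ {g | g p = 1}) :=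
    hc.inter_right (isClosed_eq (continuous_eval p) continuous_const)
  obtain ⟨g, ⟨-, hg1⟩, hg0⟩ := h1.inter_iInter_nonempty
    (fun x : {x // x ≠ p} => {g : CkTwo X | g x = 0})
    (fun x => isClosed_eq (continuous_eval x.1) continuous_const) fun u => by
      have ho : IsOpen (P \ (Subtype.val '' (u : Set {x // x ≠ p}))) :=
        hP.sdiff (u.finite_toSet.image _).isClosed
      obtain ⟨W, hW, hpW, hWP⟩ := hX.exists_subset_of_mem_open
        (u := P \ (Subtype.val '' (u : Set {x // x ≠ p})))
        ⟨hp, by rintro ⟨x, -, hx⟩; exact x.2 hx⟩ ho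
      refine ⟨ind W hW, ⟨fun x hx => ind_of_notMem hW fun h => hx (hWP h).1, ind_of_mem hW hpW⟩, ?_⟩
      refine mem_iInter₂.2 fun x hx => ind_of_notMem hW fun h => (hWP h).2 ?_
      exact mem_image_of_mem _ hx
  refine hpn ?_
  have : ({p} : Set X) = {x | g x = 1} := by
    ext x
    refine ⟨fun h => h ▸ hg1, fun h => ?_⟩
    by_contra hne
    have h2 : g x = 0 := mem_iInter.1 hg0 ⟨x, hne⟩
    have h3 : g x = 1 := h
    rw [h2] at h3
    exact zero_ne_one h3
  rw [this]
  exact (g.isClopen_fiber 1 (by simp)).isOpen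

theorem continuous_ind_inter {P : Set X} (hP : IsClopen P) :
    Continuous fun g : CkTwo X =>
      ind ({x | g x = 1} ∩ P) ((g.isClopen_fiber 1 (by simp)).inter hP) := by
  refine continuous_iff_continuousAt.2 fun g T hT => ?_
  obtain ⟨K, hK, hKT⟩ := mem_nhds_iff.1 hT
  refine Filter.mem_map.2 (Filter.mem_of_superset (eqOn_mem_nhds g hK) fun h hh => hKT fun x hx => ?_)
  have hgh : h x = g x := hh hx
  by_cases h1 : g x = 1 ∧ x ∈ P
  · refine (ind_of_mem _ ?_).trans (ind_of_mem _ ?_).symm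
    exacts [⟨hgh.trans h1.1, h1.2⟩, h1]
  · refine (ind_of_notMem _ ?_).trans (ind_of_notMem _ ?_).symm
    exacts [fun h2 => h1 ⟨hgh.symm.trans h2.1, h2.2⟩, h1]

/-- Clopen `P n` around non-isolated points escape compact sets. The functions supported in `P n`
form a closed noncompact set, so the clopen-sequence lemma, applied in `CkTwo X` itself, supplies
the dispersed `e n m`. -/
theorem containsStrongFinOmegaFan_of_not_isCompact_nonIsolatedPoints [T1Space X] [LindelofSpace X]
    [LindelofSpace (CkTwo X)] (hX : IsZeroDimensional X) {C : Set X} (hC : IsCompact C)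
    {N : ℕ → Set X} (hNa : Antitone N) (hNc : ∀ n, IsClosed (N n)) (hN : ∀ n, ¬ IsCompact (N n))
    (hNV : ∀ V, IsOpen V → C ⊆ V → ∃ n, N n ⊆ V) (hX' : ¬ IsCompact (nonIsolatedPoints X)) :
    ContainsStrongFinOmegaFan (CkTwo X) := by
  obtain ⟨P, hP, hPC, hPX, hPd, hPf⟩ :=
    hX.exists_clopen_seq (isClosed_nonIsolatedPoints X) hX' hC
  choose p hpP hp using hPX
  have hclosed : ∀ n, IsClosed {g : CkTwo X | ∀ x ∉ P n, g x = 0} := fun n => by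
    simp only [ofPred_forall]
    exact isClosed_iInter fun x => isClosed_iInter fun _ =>
      isClosed_eq (continuous_eval x) continuous_const
  choose Q hQ hQC hQH hQd hQf using fun n => isZeroDimensional.exists_clopen_seq (hclosed n)
    (not_isCompact_vanishing hX (hP n).isOpen (hpP n) (hp n)) isCompact_empty
  choose e heQ heP using hQH
  refine containsStrongFinOmegaFan_of_noncompact_seq hX hC hNa hNc hN hNV hP hPC
    (L := fun _ => ∅) (fun _ => isCompact_empty) (e := e)
    (fun n m => (hQ n m).isOpen.preimage (continuous_ind_inter (hP n)))
    (fun n m f _ hf => ?_) (fun n m x hx => heP n m x fun h => (hPC n).notMem_of_mem_left h hx)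
    (fun n => (hQf n).preimage (continuous_ind_inter (hP n))) fun B hB => ?_
  · have : ind ({x | f x = 1} ∩ P n) ((f.isClopen_fiber 1 (by simp)).inter (hP n)) = e n m := by
      refine DFunLike.coe_injective (funext fun x => ?_)
      by_cases hx : x ∈ P n
      · rw [← hf (Or.inl (Or.inr hx))]
        rcases f.apply_eq_zero_or_one x with h | h
        · rw [h]; exact ind_of_notMem _ (by simp [h])
        · rw [h]; exact ind_of_mem _ ⟨h, hx⟩
      · rw [heP n m x hx]
        exact ind_of_notMem _ fun h => hx h.2
    rw [mem_preimage, this]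
    exact heQ n m
  · have h1 : ∀ᶠ n in Filter.atTop, ¬ (B ∩ P n).Nonempty := by
      rw [← Nat.cofinite_eq_atTop]
      exact (hPf B hB).compl_mem_cofinite
    exact (h1.mono fun n hn => Filter.Eventually.frequently
      (Filter.Eventually.of_forall fun m x hx => heP n m x fun h => hn ⟨x, hx, h⟩)).frequently

/-- With `A` enumerated as `a`, `e n m` is the indicator of `a n, ..., a (n + m)`. Were these not
dispersed, compactness would give a continuous function vanishing on `C` and equal to 1 on a tail of
`A`, although `A` accumulates at a point of `C`. -/
theorem containsStrongFinOmegaFan_of_not_isClosed [T2Space X] [LindelofSpace X]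
    (hX : IsZeroDimensional X) (hctbl : {x : X | IsOpen ({x} : Set X)}.Countable)
    {C : Set X} (hC : IsCompact C) (hiso : ∀ x ∉ C, IsOpen ({x} : Set X))
    {N : ℕ → Set X} (hNa : Antitone N) (hNc : ∀ n, IsClosed (N n)) (hN : ∀ n, ¬ IsCompact (N n))
    (hNV : ∀ V, IsOpen V → C ⊆ V → ∃ n, N n ⊆ V) {A : Set X} (hAC : Disjoint A C)
    (hA : ¬ IsClosed A) (hAB : ∀ B, IsCompact B → (A ∩ B).Finite) :
    ContainsStrongFinOmegaFan (CkTwo X) := by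
  have hAi : ∀ x ∈ A, IsOpen ({x} : Set X) := fun x hx => hiso x (hAC.notMem_of_mem_left hx)
  obtain ⟨a, ha, haA⟩ := (hctbl.mono hAi).exists_injective_range_eq fun h => hA h.isClosed
  have haA' : ∀ i, a i ∈ A := fun i => haA.le (mem_range_self i)
  have haC : ∀ i, a i ∉ C := fun i => hAC.notMem_of_mem_left (haA' i)
  obtain ⟨p, hpA, hpn⟩ : ∃ p ∈ closure A, p ∉ A := by
    by_contra! h
    exact hA (isClosed_of_closure_subset h)
  have hpC : p ∈ C := by
    by_contra hp
    obtain ⟨q, rfl, hq⟩ := mem_closure_iff.1 hpA {p} (hiso p hp) rfl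
    exact hpn hq
  have hfin : ∀ n m, (a '' Icc n (n + m)).Finite := fun n m => (finite_Icc _ _).image a
  have hcl : ∀ n m, IsClopen (a '' Icc n (n + m)) := fun n m =>
    ⟨(hfin n m).isClosed, isOpen_of_forall_isOpen_singleton (by
      rintro _ ⟨i, -, rfl⟩
      exact hAi _ (haA' i))⟩
  have heC : ∀ n m, ∀ x ∈ C, ind _ (hcl n m) x = 0 := fun n m x hx =>
    ind_of_notMem _ (by rintro ⟨i, -, rfl⟩; exact haC i hx)
  refine containsStrongFinOmegaFan_of_noncompact_seq hX hC hNa hNc hN hNV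
    (P := fun _ => ∅) (fun _ => isClopen_empty) (fun _ => empty_disjoint C)
    (L := fun _ => ∅) (fun _ => isCompact_empty) (e := fun n m => ind _ (hcl n m))
    (U := fun n m => {g | EqOn g (ind _ (hcl n m)) (C ∪ a '' Icc n (n + m))})
    (fun n m => isOpen_eqOn _ (hC.union (hfin n m).isCompact)) (fun n m f hf1 hf => ?_) heC
    (fun n 𝒦 h𝒦 => ?_) fun B hB => ?_
  · rintro x (hx | hx)
    · exact hf (Or.inl (Or.inl hx))
    · rw [ind_of_mem (hcl n m) hx, hf1 x (ind_of_mem (hcl n m) hx)]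
  · by_contra hinf
    have hcC : IsClosed {g : CkTwo X | ∀ x ∈ C, g x = 0} := by
      simp only [ofPred_forall]
      exact isClosed_iInter fun x => isClosed_iInter fun _ =>
        isClosed_eq (continuous_eval x) continuous_const
    obtain ⟨g, ⟨-, hg0⟩, hg1⟩ := (h𝒦.inter_right hcC).inter_iInter_nonempty
      (fun k : ℕ => {g : CkTwo X | g (a (n + k)) = 1})
      (fun k => isClosed_eq (continuous_eval _) continuous_const) fun u => by
        obtain ⟨m, ⟨g, hg, hgm⟩, hlt⟩ := Set.Infinite.exists_gt hinf (u.sup id)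
        refine ⟨g, ⟨hg, fun x hx => (hgm (Or.inl hx)).trans (heC n m x hx)⟩,
          mem_iInter₂.2 fun k hk => ?_⟩
        have hkm : a (n + k) ∈ a '' Icc n (n + m) := mem_image_of_mem a
          ⟨Nat.le_add_right n k, Nat.add_le_add_left ((Finset.le_sup (f := id) hk).trans hlt.le) n⟩
        exact (hgm (Or.inr hkm)).trans (ind_of_mem (hcl n m) hkm)
    have hopen : IsOpen ({x | g x = 0} \ a '' Iio n) :=
      (g.isClopen_fiber 0 (by simp)).isOpen.sdiff ((finite_Iio n).image a).isClosed
    obtain ⟨q, ⟨hq0, hqn⟩, hqA⟩ := mem_closure_iff.1 hpA _ hopen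
      ⟨hg0 p hpC, by rintro ⟨i, -, rfl⟩; exact hpn (haA' i)⟩
    obtain ⟨i, rfl⟩ := haA.ge hqA
    have hni : n ≤ i := by
      by_contra hlt
      exact hqn (mem_image_of_mem a (not_le.1 hlt))
    have h1 : g (a (n + (i - n))) = 1 := mem_iInter.1 hg1 (i - n)
    rw [Nat.add_sub_cancel' hni] at h1
    have h0 : g (a i) = 0 := hq0
    rw [h0] at h1
    exact zero_ne_one h1
  · have h1 : (a ⁻¹' (A ∩ B)).Finite := (hAB B hB).preimage ha.injOn
    obtain ⟨n₀, hn₀⟩ := h1.bddAbove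
    refine Filter.Eventually.frequently ?_
    filter_upwards [Filter.eventually_gt_atTop n₀] with n hn
    refine Filter.Eventually.frequently (Filter.Eventually.of_forall fun m x hx => ?_)
    refine ind_of_notMem _ ?_
    rintro ⟨i, hi, rfl⟩
    exact absurd (hn₀ (show i ∈ a ⁻¹' (A ∩ B) from ⟨haA' i, hx⟩)) (not_le.2 (hn.trans_le hi.1))

/-- The `e n m` are indicators of the points of `B n \ C`; for fixed `n` they have distinct traces
on the compact set `C ∪ B n`, which disperses them. -/
theorem containsStrongFinOmegaFan_of_frequently_infinite [T2Space X] [LindelofSpace X]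
    (hX : IsZeroDimensional X) (hctbl : {x : X | IsOpen ({x} : Set X)}.Countable)
    {C : Set X} (hC : IsCompact C) (hiso : ∀ x ∉ C, IsOpen ({x} : Set X))
    {N : ℕ → Set X} (hNa : Antitone N) (hNc : ∀ n, IsClosed (N n)) (hN : ∀ n, ¬ IsCompact (N n))
    (hNV : ∀ V, IsOpen V → C ⊆ V → ∃ n, N n ⊆ V) {B : ℕ → Set X} (hB : ∀ n, IsCompact (B n))
    (hBK : ∀ K, IsCompact K → ∃ᶠ n in Filter.atTop, (B n \ K).Infinite) :
    ContainsStrongFinOmegaFan (CkTwo X) := by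
  classical
  -- Indices with `B n \ C` finite never count in `hBK` once `K` is enlarged by `C`, so those sets
  -- can be replaced by one fixed `B k`.
  wlog hBC : ∀ n, (B n \ C).Infinite generalizing B
  · obtain ⟨k, hk⟩ := (hBK C hC).exists
    refine this (B := fun n => if (B n \ C).Infinite then B n else B k) (fun n => ?_)
      (fun K hK => (hBK (K ∪ C) (hK.union hC)).mono fun n hn => ?_) fun n => ?_
    · split_ifs
      exacts [hB n, hB k]
    · rw [if_pos (hn.mono (sdiff_subset_sdiff_right subset_union_right))]
      exact hn.mono (sdiff_subset_sdiff_right subset_union_left)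
    · split_ifs with h
      exacts [h, hk]
  choose b hb hbB using fun n => (hctbl.mono
    fun x (hx : x ∈ B n \ C) => hiso x hx.2).exists_injective_range_eq (hBC n)
  have hbB' : ∀ n m, b n m ∈ B n \ C := fun n m => (hbB n).le (mem_range_self m)
  have hcl : ∀ n m, IsClopen {b n m} := fun n m => ⟨isClosed_singleton, hiso _ (hbB' n m).2⟩
  refine containsStrongFinOmegaFan_of_noncompact_seq hX hC hNa hNc hN hNV
    (P := fun _ => ∅) (fun _ => isClopen_empty) (fun _ => empty_disjoint C)
    hB (e := fun n m => ind _ (hcl n m))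
    (U := fun n m => {g | EqOn g (ind _ (hcl n m)) (C ∪ B n)})
    (fun n m => isOpen_eqOn _ (hC.union (hB n)))
    (fun n m f _ hf => hf.mono (union_subset_union_left _ subset_union_left))
    (fun n m x hx => ind_of_notMem _ fun h => (hbB' n m).2 (h ▸ hx))
    (fun n => compactFinite_eqOn _ (hC.union (hB n)) fun i j hij => ?_) fun K hK => ?_
  · by_contra hne
    have h := hij (Or.inr (hbB' n i).1)
    rw [ind_of_mem (hcl n i) rfl, ind_of_notMem (hcl n j) fun h => hne (hb n h)] at h
    exact one_ne_zero h
  · refine (hBK (K ∪ C) (hK.union hC)).mono fun n hn => ?_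
    rw [Nat.frequently_atTop_iff_infinite]
    intro hfin
    refine hn ((hfin.image (b n)).subset fun x hx => ?_)
    obtain ⟨m, rfl⟩ := (hbB n).ge ⟨hx.1, fun h => hx.2 (Or.inr h)⟩
    exact mem_image_of_mem _ fun y hy => ind_of_notMem _ fun h => hx.2 (Or.inl (h ▸ hy))

end CkTwo

/-! ### Second countability and the equivalence -/

/-- A non-open `M ⊇ C` has a compact witness meeting `Mᶜ` infinitely often. One compact `K` almost
contains all witnesses for `M ∈ 𝓜`, so every member of `𝓜` containing `K ∪ C` is open. -/
theorem secondCountableTopology_of_isCompactNetwork {X : Type*} [TopologicalSpace X]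
    (hX : IsZeroDimensional X) {𝓜 : Set (Set X)} (hc : 𝓜.Countable) (h𝓜 : IsCompactNetwork 𝓜)
    (hunion : ∀ A ∈ 𝓜, ∀ B ∈ 𝓜, A ∪ B ∈ 𝓜) {C : Set X} (hC : IsCompact C)
    (hclosed : ∀ A : Set X, Disjoint A C → (∀ B, IsCompact B → (A ∩ B).Finite) → IsClosed A)
    (hbound : ∀ B : ℕ → Set X, (∀ n, IsCompact (B n)) →
      ∃ K, IsCompact K ∧ ∀ᶠ n in Filter.atTop, (B n \ K).Finite) :
    SecondCountableTopology X := by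
  have hex : ∀ M : Set X, ∃ B, IsCompact B ∧ (C ⊆ M → ¬ IsOpen M → (Mᶜ ∩ B).Infinite) := fun M => by
    by_cases h : C ⊆ M ∧ ¬ IsOpen M
    · by_contra! hcon
      refine h.2 (isClosed_compl_iff.1 (hclosed _ ?_ fun B hB => ?_))
      · exact disjoint_left.2 fun x hx hxC => hx (h.1 hxC)
      · exact not_infinite.1 (by simpa using (hcon B hB).2.2)
    · exact ⟨∅, isCompact_empty, fun h1 h2 => absurd ⟨h1, h2⟩ h⟩
  choose B hB hBM using hex
  obtain ⟨K, hK, hKB⟩ : ∃ K, IsCompact K ∧ ∀ M ∈ 𝓜, (B M \ K).Finite := by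
    rcases 𝓜.eq_empty_or_nonempty with rfl | hne
    · exact ⟨∅, isCompact_empty, by simp⟩
    obtain ⟨u, rfl⟩ := hc.exists_eq_range hne
    obtain ⟨K, hK, h⟩ := hbound (fun n => ⋃ i ∈ Iic n, B (u i)) fun n =>
      (finite_Iic n).isCompact_biUnion fun i _ => hB _
    refine ⟨K, hK, ?_⟩
    rintro _ ⟨i, rfl⟩
    obtain ⟨n, hn, hin⟩ := (h.and (Filter.eventually_ge_atTop i)).exists
    exact hn.subset (sdiff_subset_sdiff_left (subset_biUnion_of_mem (u := fun i => B (u i)) hin))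
  have hopen : ∀ M ∈ 𝓜, K ∪ C ⊆ M → IsOpen M := fun M hM hKM => by
    by_contra hMo
    refine hBM M (subset_union_right.trans hKM) hMo ((hKB M hM).subset ?_)
    exact fun x hx => ⟨hx.2, fun h => hx.1 (hKM (Or.inl h))⟩
  refine secondCountableTopology_of_countable_network hc fun x U hU hx => ?_
  obtain ⟨W, hW, hxW, hWU⟩ := hX.exists_subset_of_mem_open hx hU
  have hW : IsClopen W := hW
  obtain ⟨M, hM, h1, h2⟩ := h𝓜 W _ hW.isOpen
    (((hK.union hC).insert x).inter_right hW.isClosed) inter_subset_right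
  obtain ⟨M', hM', h3, h4⟩ := h𝓜 Wᶜ _ hW.compl.isOpen
    ((hK.union hC).inter_right hW.compl.isClosed) inter_subset_right
  have ho := hopen _ (hunion M hM M' hM') fun y hy => by
    by_cases hyW : y ∈ W
    · exact Or.inl (h1 ⟨Or.inr hy, hyW⟩)
    · exact Or.inr (h3 ⟨hy, hyW⟩)
  refine ⟨M, hM, ?_, h1 ⟨Or.inl rfl, hxW⟩, h2.trans hWU⟩
  -- `M` alone need not contain `K ∪ C`, but `M ∪ M'` does, and the clopen `W` cuts `M` out of it.
  have e : M = (M ∪ M') ∩ W := by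
    ext y
    exact ⟨fun h => ⟨Or.inl h, h2 h⟩, fun h => h.1.resolve_right fun h' => h4 h' h.2⟩
  rw [e]
  exact ho.inter hW.isOpen

theorem isHemicompact_or_polishSpace {X : Type*} [TopologicalSpace X]
    (hzero : IsZeroDimensional X) (haleph : IsAlephZeroSpace X)
    (hfan : ¬ ContainsStrongFinOmegaFan (CkTwo X)) :
    IsHemicompact X ∨ (PolishSpace X ∧ IsCompact (nonIsolatedPoints X)) := by
  obtain ⟨_, 𝒩, hc, h𝒩⟩ := haleph
  have := h𝒩.isNetwork.lindelofSpace hc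
  have hctbl := h𝒩.isNetwork.countable_isolated hc
  obtain ⟨𝓜, hMc, h𝓜, hunion⟩ := h𝒩.exists_isCompactNetwork hc
  obtain ⟨𝒩', hc', h𝒩'⟩ := CkTwo.exists_countable_network hMc h𝓜
  have := h𝒩'.lindelofSpace hc'
  refine or_iff_not_imp_left.2 fun hX => ?_
  have hX' : IsCompact (nonIsolatedPoints X) := by
    by_contra hX'
    obtain ⟨C, hC, -, N, hNa, hNc, hN, hNV⟩ := exists_noncompact_seq hMc h𝓜 hX isCompact_empty
    exact hfan (CkTwo.containsStrongFinOmegaFan_of_not_isCompact_nonIsolatedPoints hzero hC hNa hNc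
      hN hNV hX')
  -- Now `C` can be taken to contain `X'`, so that every point off `C` is isolated.
  obtain ⟨C, hC, hXC, N, hNa, hNc, hN, hNV⟩ := exists_noncompact_seq hMc h𝓜 hX hX'
  have hiso : ∀ x ∉ C, IsOpen ({x} : Set X) := fun x hx => by
    by_contra h
    exact hx (hXC h)
  have : SecondCountableTopology X := by
    refine secondCountableTopology_of_isCompactNetwork hzero hMc h𝓜 hunion hC
      (fun A hAC hAB => ?_) fun B hB => ?_
    · by_contra hA
      exact hfan (CkTwo.containsStrongFinOmegaFan_of_not_isClosed hzero hctbl hC hiso hNa hNc hN hNV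
        hAC hA hAB)
    · by_contra! hcon
      exact hfan (CkTwo.containsStrongFinOmegaFan_of_frequently_infinite hzero hctbl hC hiso hNa hNc
        hN hNV hB fun K hK => by simpa using hcon K hK)
  refine ⟨?_, hX'⟩
  -- `C` may be empty, whereas the metric construction needs a nonempty compact set.
  obtain ⟨x, -⟩ : (N 0).Nonempty := by
    rw [nonempty_iff_ne_empty]
    intro h
    exact hN 0 (h ▸ isCompact_empty)
  exact polishSpace_of_isolated_compl (hC.insert x) (insert_nonempty x C) fun y hy =>
    hiso y fun h => hy (Or.inr h)

theorem theorem5p3p6 {X : Type*} [TopologicalSpace X]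
    (hzero : IsZeroDimensional X) (haleph : IsAlephZeroSpace X) :
    List.TFAE
      [ TopologicalSpace.MetrizableSpace (CkTwo X) ∨
          (IsCosmic (CkTwo X) ∧ IsKOmegaSpace (CkTwo X)),
        SequentialSpace (CkTwo X),
        CompactlyCoherentSpace (CkTwo X),
        IsAscoli (CkTwo X),
        ¬ ContainsStrongFinOmegaFan (CkTwo X),
        IsHemicompact X ∨ (PolishSpace X ∧ IsCompact (nonIsolatedPoints X)) ] := by
  obtain ⟨_, 𝒩, hc, h𝒩⟩ := id haleph
  have := h𝒩.isNetwork.separableSpace hc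
  obtain ⟨𝓜, hMc, h𝓜, -⟩ := h𝒩.exists_isCompactNetwork hc
  tfae_have 1 → 2
  | .inl h => inferInstance
  | .inr ⟨_, h⟩ => by
    have := h.compactlyCoherentSpace
    exact CkTwo.sequentialSpace
  tfae_have 2 → 3 := fun h => inferInstance
  have : T35Space (CkTwo X) := { }
  tfae_have 3 → 4 := fun h => CompactlyCoherentSpace.isAscoli
  tfae_have 4 → 5 := IsAscoli.not_containsStrongFinOmegaFan
  tfae_have 5 → 6 := isHemicompact_or_polishSpace hzero haleph
  tfae_have 6 → 1
  | .inl h => .inl (CkTwo.metrizableSpace_of_isHemicompact hMc h𝓜 h)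
  | .inr ⟨_, h⟩ => .inr ⟨CkTwo.isCosmic hMc h𝓜, CkTwo.isKOmegaSpace hMc h𝓜 h⟩
  tfae_finish
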